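/- Let $V=\mathbb{C}^8$ with the symmetric bilinear form $(x|y)=\sum_i x_iy_i$, let $\phi=(\tfrac12,\dots,\tfrac12)\in V$, and let $P=\{a\in\mathbb{Z}^8\cup(\phi+\mathbb{Z}^8) : (\phi|a)\in\mathbb{Z}\}$ be the root lattice of type $E_8$. A $C_3$-frame is a set $\{\pm a_0,\pm a_1,\pm a_2\}\subset V$ with $(a_i|a_j)=\delta_{ij}$, $a_i\pm a_j\in P$ for $i<j$, and $2a_i\in P$. Let $[z]$ be a nonzero entire function of $z\in\mathbb{C}$ such that, with the abbreviation $[\alpha\pm\beta]=[\alpha+\beta][\alpha-\beta]$, $$[\beta\pm\gamma][z\pm\alpha]+[\gamma\pm\alpha][z\pm\beta]+[\alpha\pm\beta][z\pm\gamma]=0\qquad(z,\alpha,\beta,\gamma\in\mathbb{C}).$$ Let $\delta\in\mathbb{C}$, $\delta\neq0$, be such that $\mathbb{Z}\delta\cap\{\omega:[\omega]=0\}=\{0\}$, and let $c\in\mathbb{C}$. For $\kappa\in\mathbb{C}$ put $H_\kappa=\{x\in V:(\phi|x)=\kappa\}$. Write $[(u\pm v|x)]=[(u+v|x)][(u-v|x)]$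 and $\tau(x\pm v)=\tau(x+v)\tau(x-v)$. For meromorphic functions $\tau^{(m)}$ on $H_{c+m\delta}$ consider the following equations (identities of meromorphic functions). * $({\rm I})_{m+1/2}$, for all $C_3$-frames with $(\phi|a_0)=(\phi|a_1)=(\phi|a_2)=\tfrac12$, $x\in H_{c+(m+1/2)\delta}$: $$[(a_1\pm a_2|x)]\,\tau^{(m)}(x-a_0\delta)\tau^{(m+1)}(x+a_0\delta)+[(a_2\pm a_0|x)]\,\tau^{(m)}(x-a_1\delta)\tau^{(m+1)}(x+a_1\delta)+[(a_0\pm a_1|x)]\,\tau^{(m)}(x-a_2\delta)\tau^{(m+1)}(x+a_2\delta)=0.$$ * $({\rm II}_0)_m$, for all $C_3$-frames with $(\phi|a_0)=(\phi|a_1)=(\phi|a_2)=0$, $x\in H_{c+m\delta}$: $$[(a_1\pm a_2|x)]\,\tau^{(m)}(x\pm a_0\delta)+[(a_2\pm a_0|x)]\,\tau^{(m)}(x\pm a_1\delta)+[(a_0\pm a_1|x)]\,\tau^{(m)}(x\pm a_2\delta)=0.$$ * $({\rm II}_1)_m$, for all $C_3$-frames with $(\phi|a_0)=1$, $(\phi|a_1)=(\phi|a_2)=0$,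 $x\in H_{c+m\delta}$: $$[(a_1\pm a_2|x)]\,\tau^{(m-1)}(x-a_0\delta)\tau^{(m+1)}(x+a_0\delta)=[(a_0\pm a_2|x)]\,\tau^{(m)}(x\pm a_1\delta)-[(a_0\pm a_1|x)]\,\tau^{(m)}(x\pm a_2\delta).$$ * $({\rm II}_2)_m$, for all $C_3$-frames with $(\phi|a_0)=(\phi|a_1)=1$, $(\phi|a_2)=0$, $x\in H_{c+m\delta}$: $$[(a_1\pm a_2|x)]\,\tau^{(m-1)}(x-a_0\delta)\tau^{(m+1)}(x+a_0\delta)-[(a_0\pm a_2|x)]\,\tau^{(m-1)}(x-a_1\delta)\tau^{(m+1)}(x+a_1\delta)=[(a_1\pm a_0|x)]\,\tau^{(m)}(x\pm a_2\delta).$$ **Theorem (recursion theorem).** Let $n\in\mathbb{Z}$, and let $\tau^{(n-1)}$ and $\tau^{(n)}$ be meromorphic functions on $H_{c+(n-1)\delta}$ and $H_{c+n\delta}$, respectively. Suppose that $\tau^{(n-1)}\not\equiv0$, that $\tau^{(n-1)},\tau^{(n)}$ satisfy all the equations of type $({\rm I})_{n-1/2}$, and that $\tau^{(n)}$ satisfies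 all the equations of type $({\rm II}_0)_n$. Then there exists a unique meromorphic function $\tau^{(n+1)}$ on $H_{c+(n+1)\delta}$ such that $\tau^{(n-1)},\tau^{(n)},\tau^{(n+1)}$ satisfy all the equations of type $({\rm II}_1)_n$. Furthermore, this $\tau^{(n+1)}$ satisfies the following: $\tau^{(n-1)},\tau^{(n)},\tau^{(n+1)}$ satisfy all the equations of type $({\rm II}_2)_n$; $\tau^{(n)},\tau^{(n+1)}$ satisfy all the equations of type $({\rm I})_{n+1/2}$; and $\tau^{(n+1)}$ satisfies all the equations of type $({\rm II}_0)_{n+1}$. -/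

import Mathlib

open scoped Topology

namespace ORG

/-- The space `ℂ⁸`; its symmetric bilinear form is the (bilinear) dot product `⬝ᵥ`. -/
abbrev V : Type := Fin 8 → ℂ

/-- The vector `φ = (1/2, …, 1/2)`. -/
noncomputable def phi : V := fun _ => 1 / 2

/-- The root lattice `P = Q(E₈)`: vectors of `ℤ⁸ ∪ (φ + ℤ⁸)` with `(φ|a) ∈ ℤ`. -/
def E8Lattice : Set V :=
  {a | ((∀ i, ∃ m : ℤ, a i = m) ∨ (∀ i, ∃ m : ℤ, a i = phi i + m)) ∧
    ∃ m : ℤ, phi ⬝ᵥ a = m}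

/-- The vectors `a 0, …, a (l-1)` determine a `C_l`-frame `{±a 0, …, ±a (l-1)}` relative to
the `E₈` lattice. -/
structure IsCFrame {l : ℕ} (a : Fin l → V) : Prop where
  orthonormal : ∀ i j, a i ⬝ᵥ a j = if i = j then 1 else 0
  add_mem : ∀ i j, i < j → a i + a j ∈ E8Lattice
  sub_mem : ∀ i j, i < j → a i - a j ∈ E8Lattice
  two_smul_mem : ∀ i, (2 : ℂ) • a i ∈ E8Lattice

/-- A nonzero entire function `[z] = s z` satisfying the three-term relation. -/
structure IsBracket (s : ℂ → ℂ) : Prop where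
  entire : Differentiable ℂ s
  ne_zero : s ≠ 0
  three_term : ∀ z α β γ : ℂ,
    s (β + γ) * s (β - γ) * (s (z + α) * s (z - α)) +
    s (γ + α) * s (γ - α) * (s (z + β) * s (z - β)) +
    s (α + β) * s (α - β) * (s (z + γ) * s (z - γ)) = 0

/-- `[(u ± v | x)] = [(u + v | x)] [(u - v | x)]`. -/
def pm (s : ℂ → ℂ) (u v x : V) : ℂ := s ((u + v) ⬝ᵥ x) * s ((u - v) ⬝ᵥ x)

/-- The affine hyperplane `H_κ = {x : (φ|x) = κ}`. -/
def Hyp (κ : ℂ) : Set V := {x | phi ⬝ᵥ x = κ}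

/-- The filter of sets that contain a dense open set. -/
def generic (X : Type*) [TopologicalSpace X] : Filter X where
  sets := {S | Dense (interior S)}
  univ_sets := by simp
  sets_of_superset h hst := h.mono (interior_mono hst)
  inter_sets h h' := by
    simpa [interior_inter] using h.inter_of_isOpen_left h' isOpen_interior

/-- `f` agrees near `p ∈ H_κ`, off the zeros of the denominator, with a quotient of two functions
holomorphic on `H_κ` near `p` whose denominator does not vanish identically near `p`.
(Functions holomorphic on `H_κ` near `p` are the restrictions of functions holomorphic near `p` in
the ambient space.) -/
def IsMeromorphicAt {κ : ℂ} (f : Hyp κ → ℂ) (p : Hyp κ) : Prop :=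
  ∃ g h : V → ℂ, AnalyticAt ℂ g p ∧ AnalyticAt ℂ h p ∧
    (∃ᶠ x : Hyp κ in 𝓝 p, h x ≠ 0) ∧
    ∀ᶠ x : Hyp κ in 𝓝 p, h x ≠ 0 → f x = g x / h x

/-- Meromorphic functions on `H_κ`: functions that are locally quotients of holomorphic functions,
where two functions that agree on a dense open set are identified (values on the polar set
are irrelevant). -/
def MeroFun (κ : ℂ) : Type :=
  {τ : Filter.Germ (generic (Hyp κ)) ℂ //
    ∃ f : Hyp κ → ℂ, (∀ p, IsMeromorphicAt f p) ∧ (f : Filter.Germ (generic (Hyp κ)) ℂ) = τ}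

namespace MeroFun

/-- The meromorphic function vanishes identically. -/
def IsZero {κ : ℂ} (τ : MeroFun κ) : Prop := τ.1 = 0

/-- A function representing `τ`. -/
noncomputable def rep {κ : ℂ} (τ : MeroFun κ) : Hyp κ → ℂ := τ.2.choose

theorem rep_spec {κ : ℂ} (τ : MeroFun κ) :
    (∀ p, IsMeromorphicAt τ.rep p) ∧ (τ.rep : Filter.Germ (generic (Hyp κ)) ℂ) = τ.1 :=
  τ.2.choose_spec

open Classical in
/-- The value of a representative of `τ` at points `y ∈ H_κ` (and `0` at other points of `V`).
It is used only in identities required on a dense open set, which do not depend on the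
representative, by `eval_eq` and `eventually_shift` below. -/
noncomputable def eval {κ : ℂ} (τ : MeroFun κ) (y : V) : ℂ :=
  if h : y ∈ Hyp κ then τ.rep ⟨y, h⟩ else 0

noncomputable instance {κ : ℂ} : CoeFun (MeroFun κ) (fun _ => V → ℂ) := ⟨eval⟩

/-- `eval` agrees generically with every representative. -/
theorem eval_eq {κ : ℂ} (τ : MeroFun κ) (f : Hyp κ → ℂ)
    (hf : (f : Filter.Germ (generic (Hyp κ)) ℂ) = τ.1) :
    ∀ᶠ x : Hyp κ in generic (Hyp κ), τ x = f x := by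
  have h : τ.rep =ᶠ[generic (Hyp κ)] f :=
    Filter.Germ.coe_eq.1 (τ.rep_spec.2.trans hf.symm)
  filter_upwards [h] with x hx
  have hm : (x : V) ∈ Hyp κ := x.2
  simp only [eval, hm, dif_pos]
  exact hx

end MeroFun

/-- Generic properties on hyperplanes are stable under translation. -/
theorem eventually_shift {κ κ' : ℂ} (v : V) (hv : κ + phi ⬝ᵥ v = κ') (p : V → Prop)
    (hp : ∀ᶠ y : Hyp κ' in generic (Hyp κ'), p y) :
    ∀ᶠ x : Hyp κ in generic (Hyp κ), p (x + v) := by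
  have h1 : ∀ x : Hyp κ, (x : V) + v ∈ Hyp κ' := fun x => by
    have := x.2
    simp only [Hyp, Set.mem_ofPred_eq, dotProduct_add] at this ⊢
    rw [this, hv]
  have h2 : ∀ y : Hyp κ', (y : V) - v ∈ Hyp κ := fun y => by
    have := y.2
    simp only [Hyp, Set.mem_ofPred_eq, dotProduct_sub] at this ⊢
    rw [this, ← hv]; ring
  let e : Hyp κ ≃ₜ Hyp κ' :=
    { toFun := fun x => ⟨x + v, h1 x⟩
      invFun := fun y => ⟨y - v, h2 y⟩
      left_inv := fun x => by simp
      right_inv := fun y => by simp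
      continuous_toFun := by fun_prop
      continuous_invFun := by fun_prop }
  have hp' : Dense (interior {y : Hyp κ' | p y}) := hp
  change Dense (interior (e ⁻¹' {y : Hyp κ' | p y}))
  rw [← e.preimage_interior]
  exact hp'.preimage e.isOpenMap

/-- All bilinear equations of type (I) on `H_κ`, between `τ` (on the level `κ - δ/2`) and
`τ'` (on the level `κ + δ/2`). -/
def HirotaI (s : ℂ → ℂ) (δ κ : ℂ) {κ₀ κ₁ : ℂ} (τ : MeroFun κ₀) (τ' : MeroFun κ₁) : Prop :=
  ∀ a : Fin 3 → V, IsCFrame a → (∀ i, phi ⬝ᵥ a i = 1 / 2) →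
    ∀ᶠ x : Hyp κ in generic (Hyp κ),
      pm s (a 1) (a 2) x * (τ (x - δ • a 0) * τ' (x + δ • a 0)) +
      pm s (a 2) (a 0) x * (τ (x - δ • a 1) * τ' (x + δ • a 1)) +
      pm s (a 0) (a 1) x * (τ (x - δ • a 2) * τ' (x + δ • a 2)) = 0

/-- All bilinear equations of type (II₀) for `τ` on `H_κ`. -/
def HirotaII0 (s : ℂ → ℂ) (δ : ℂ) {κ : ℂ} (τ : MeroFun κ) : Prop :=
  ∀ a : Fin 3 → V, IsCFrame a → (∀ i, phi ⬝ᵥ a i = 0) →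
    ∀ᶠ x : Hyp κ in generic (Hyp κ),
      pm s (a 1) (a 2) x * (τ (x + δ • a 0) * τ (x - δ • a 0)) +
      pm s (a 2) (a 0) x * (τ (x + δ • a 1) * τ (x - δ • a 1)) +
      pm s (a 0) (a 1) x * (τ (x + δ • a 2) * τ (x - δ • a 2)) = 0

/-- All bilinear equations of type (II₁) on `H_κ`, for `τ` on the level `κ` and `τm`, `τp`
(on the levels `κ - δ`, `κ + δ`). -/
def HirotaII1 (s : ℂ → ℂ) (δ : ℂ) {κm κ κp : ℂ}
    (τm : MeroFun κm) (τ : MeroFun κ) (τp : MeroFun κp) : Prop :=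
  ∀ a : Fin 3 → V, IsCFrame a → phi ⬝ᵥ a 0 = 1 → phi ⬝ᵥ a 1 = 0 → phi ⬝ᵥ a 2 = 0 →
    ∀ᶠ x : Hyp κ in generic (Hyp κ),
      pm s (a 1) (a 2) x * (τm (x - δ • a 0) * τp (x + δ • a 0)) =
        pm s (a 0) (a 2) x * (τ (x + δ • a 1) * τ (x - δ • a 1)) -
        pm s (a 0) (a 1) x * (τ (x + δ • a 2) * τ (x - δ • a 2))

/-- All bilinear equations of type (II₂) on `H_κ`, for `τ` on the level `κ` and `τm`, `τp`
(on the levels `κ - δ`, `κ + δ`). -/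
def HirotaII2 (s : ℂ → ℂ) (δ : ℂ) {κm κ κp : ℂ}
    (τm : MeroFun κm) (τ : MeroFun κ) (τp : MeroFun κp) : Prop :=
  ∀ a : Fin 3 → V, IsCFrame a → phi ⬝ᵥ a 0 = 1 → phi ⬝ᵥ a 1 = 1 → phi ⬝ᵥ a 2 = 0 →
    ∀ᶠ x : Hyp κ in generic (Hyp κ),
      pm s (a 1) (a 2) x * (τm (x - δ • a 0) * τp (x + δ • a 0)) -
      pm s (a 0) (a 2) x * (τm (x - δ • a 1) * τp (x + δ • a 1)) =
        pm s (a 1) (a 0) x * (τ (x + δ • a 2) * τ (x - δ • a 2))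

end ORG

namespace ORG

/-! A frame vector `a₀` with `(φ|a₀) = 1` is `(φ+α)/2` for the root `α = 2a₀ - φ` of `E₇ = φ^⊥`. The
vectors `u` orthogonal to `φ` that complete `a₀` to a frame are `u = l - a₀` with `l` a root
satisfying `(φ|l) = (α|l) = 1`, a weight of `α`. After translation by `δa₀`, every equation (II₁)
becomes an equation at `x` whose left side is a bracket coefficient times `τ₀(x - δ(φ+α)) τ₂(x)`
(`eqII1_iff_weightEq`). The coefficient is generically nonzero, so one such equation determines
`τ₂`; the content of existence is that all of them determine the same function.

For a fixed `α`, the three-term relation and (II₀) allow one frame member to be exchanged for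
another (`EqII1.exchange`). For two roots with `(α|β) = 1` and common weights `l`, `l'`, two
equations (I), interchanged by `l ↔ l'`, turn the equation of `α` into that of `β`
(`WeightEq.of_linked`). The `E₇` roots are connected by such links (`IsE7Root.induction`), so one
equation yields all.

The remaining families follow from (II₁) by adjoining a fourth vector `b` to the frame. Two
equations (II₁) give (II₂). Three of them, arranged to share one factor `τ₀(z - δ(φ-b))`, give (I)
at the next level. Three others, combined with two of these new equations (I), give (II₀) for `τ₂`.
The common factors are cancelled because a product of nonzero meromorphic functions on the connected
hyperplane is generically nonzero. -/

/-! ### The `E₈` lattice: closure properties, evenness, positivity. -/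

theorem E8Lattice.add_mem {x y : V} (hx : x ∈ E8Lattice) (hy : y ∈ E8Lattice) :
    x + y ∈ E8Lattice := by
  obtain ⟨hx, m, hm⟩ := hx
  obtain ⟨hy, k, hk⟩ := hy
  refine ⟨?_, m + k, by rw [dotProduct_add, hm, hk]; push_cast; ring⟩
  rcases hx with hx | hx <;> rcases hy with hy | hy
  · left; intro i; obtain ⟨p, hp⟩ := hx i; obtain ⟨q, hq⟩ := hy i
    exact ⟨p + q, by simp [hp, hq]⟩
  · right; intro i; obtain ⟨p, hp⟩ := hx i; obtain ⟨q, hq⟩ := hy i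
    exact ⟨p + q, by simp [hp, hq]; ring⟩
  · right; intro i; obtain ⟨p, hp⟩ := hx i; obtain ⟨q, hq⟩ := hy i
    exact ⟨p + q, by simp [hp, hq]; ring⟩
  · left; intro i; obtain ⟨p, hp⟩ := hx i; obtain ⟨q, hq⟩ := hy i
    exact ⟨p + q + 1, by simp [hp, hq, phi]; ring⟩

theorem E8Lattice.neg_mem {x : V} (hx : x ∈ E8Lattice) : -x ∈ E8Lattice := by
  obtain ⟨hx, m, hm⟩ := hx
  refine ⟨?_, -m, by rw [dotProduct_neg, hm]; push_cast; ring⟩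
  rcases hx with hx | hx
  · left; intro i; obtain ⟨p, hp⟩ := hx i
    exact ⟨-p, by simp [hp]⟩
  · right; intro i; obtain ⟨p, hp⟩ := hx i
    exact ⟨-p - 1, by simp [hp, phi]; ring⟩

theorem E8Lattice.sub_mem {x y : V} (hx : x ∈ E8Lattice) (hy : y ∈ E8Lattice) :
    x - y ∈ E8Lattice := by
  rw [sub_eq_add_neg]; exact add_mem hx (neg_mem hy)

theorem E8Lattice.intCast_smul_mem {x : V} (hx : x ∈ E8Lattice) (m : ℤ) :
    (m : ℂ) • x ∈ E8Lattice := by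
  obtain ⟨hx, k, hk⟩ := hx
  refine ⟨?_, m * k, by rw [dotProduct_smul, hk]; simp⟩
  rcases hx with hx | hx
  · left; intro i; obtain ⟨p, hp⟩ := hx i
    exact ⟨m * p, by simp [hp]⟩
  · choose p hp using hx
    rcases Int.even_or_odd' m with ⟨q, rfl | rfl⟩
    · left; intro i
      exact ⟨q + 2 * q * p i, by simp [hp, phi]; ring⟩
    · right; intro i
      exact ⟨q + (2 * q + 1) * p i, by simp [hp, phi]; ring⟩

theorem phi_dotProduct_phi : phi ⬝ᵥ phi = 2 := by
  simp [phi, dotProduct]; norm_num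

theorem phi_mem : phi ∈ E8Lattice :=
  ⟨Or.inr fun _ => ⟨0, by simp⟩, 2, by rw [phi_dotProduct_phi]; norm_num⟩

theorem phi_dotProduct_eq_sum (x : V) : phi ⬝ᵥ x = (∑ i, x i) / 2 := by
  simp [phi, dotProduct, ← Finset.mul_sum]; ring

/-- This parity transfer makes the norm even on both cosets of the lattice. -/
theorem even_sum_sq_of_even_sum {ι : Type*} (s : Finset ι) (m : ι → ℤ) (h : Even (∑ i ∈ s, m i)) :
    Even (∑ i ∈ s, m i ^ 2) := by
  have : Even (∑ i ∈ s, (m i ^ 2 - m i)) := by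
    refine Finset.even_sum _ fun i _ => ?_
    rw [show m i ^ 2 - m i = m i * (m i - 1) by ring]
    exact Int.even_mul_pred_self _
  rw [Finset.sum_sub_distrib] at this
  simpa using this.add h

theorem even_sum_of_mem {x : V} {m : Fin 8 → ℤ} (hx : ∃ k : ℤ, phi ⬝ᵥ x = k)
    (hm : ∀ i, x i = m i) : Even (∑ i, m i) := by
  obtain ⟨k, hk⟩ := hx
  rw [phi_dotProduct_eq_sum, Finset.sum_congr rfl fun i _ => hm i] at hk
  refine ⟨k, ?_⟩
  have : (∑ i, (m i : ℂ)) = k + k := by linear_combination 2 * hk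
  exact_mod_cast this

theorem even_sum_of_half_mem {x : V} {m : Fin 8 → ℤ} (hx : ∃ k : ℤ, phi ⬝ᵥ x = k)
    (hm : ∀ i, x i = phi i + m i) : Even (∑ i, m i) := by
  obtain ⟨k, hk⟩ := hx
  rw [phi_dotProduct_eq_sum, Finset.sum_congr rfl fun i _ => hm i, Finset.sum_add_distrib] at hk
  -- The coordinates of `φ` add up to 4, which lowers half the sum of the `m i` by 2.
  refine ⟨k - 2, ?_⟩
  have : (∑ i, (m i : ℂ)) = (k - 2) + (k - 2) := by
    have h2 : ∑ i, phi i = 4 := by simp [phi]; norm_num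
    linear_combination 2 * hk - h2
  exact_mod_cast this

/-- The lattice is even and positive definite. -/
theorem exists_dotProduct_self {x : V} (hx : x ∈ E8Lattice) :
    ∃ k : ℕ, x ⬝ᵥ x = 2 * k ∧ (k = 0 → x = 0) := by
  obtain ⟨hx, hk⟩ := hx
  rcases hx with hx | hx
  · choose m hm using hx
    obtain ⟨q, hq⟩ := even_sum_sq_of_even_sum _ m (even_sum_of_mem hk hm)
    have hq0 : 0 ≤ q := by
      have : 0 ≤ ∑ i, m i ^ 2 := Finset.sum_nonneg fun i _ => sq_nonneg _
      omega
    lift q to ℕ using hq0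
    refine ⟨q, ?_, ?_⟩
    · simp only [dotProduct, hm]
      have : (∑ i, (m i : ℂ) ^ 2) = q + q := by exact_mod_cast hq
      simp_rw [← sq, this]; ring
    · rintro rfl
      have : ∑ i, m i ^ 2 = 0 := by simpa using hq
      rw [Finset.sum_eq_zero_iff_of_nonneg fun i _ => sq_nonneg _] at this
      ext i
      simpa [hm] using this i
  · choose m hm using hx
    have he := even_sum_of_half_mem hk hm
    obtain ⟨p, hp⟩ := he
    obtain ⟨q, hq⟩ := even_sum_sq_of_even_sum _ m ⟨p, hp⟩
    have h1 : ∀ i, 0 ≤ m i ^ 2 + m i := fun i => by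
      rcases le_or_gt 0 (m i) with h | h <;> nlinarith
    have h2 : 0 ≤ ∑ i, (m i ^ 2 + m i) := Finset.sum_nonneg fun i _ => h1 i
    rw [Finset.sum_add_distrib] at h2
    -- The norm of `φ + m` is `∑ (1/4 + m + m²) = 2(1 + p + q)`. Each `m² + m` is nonnegative, so
    -- the half-norm is at least 1 and a half-integral vector is never zero.
    have hq0 : 0 ≤ 1 + p + q := by omega
    refine ⟨(1 + p + q).toNat, ?_, fun h => by omega⟩
    have : (((1 + p + q).toNat : ℤ) : ℂ) = ((1 + p + q : ℤ) : ℂ) := by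
      rw [Int.toNat_of_nonneg hq0]
    rw [Int.cast_natCast] at this
    rw [this]
    have e1 : (∑ i, (m i : ℂ) ^ 2) = q + q := by exact_mod_cast hq
    have e2 : (∑ i, (m i : ℂ)) = p + p := by exact_mod_cast hp
    simp only [dotProduct, hm]
    have : ∀ i, (phi i + m i) * (phi i + m i) = 1 / 4 + m i + (m i : ℂ) ^ 2 := fun i => by
      simp only [phi]; ring
    simp_rw [this, Finset.sum_add_distrib, e1, e2]
    simp; ring

/-- The bilinear form on `ℂ⁸` has isotropic vectors; the lattice has none, because its vectors are
real. -/
theorem eq_zero_of_dotProduct_self {x : V} (hx : x ∈ E8Lattice) (h : x ⬝ᵥ x = 0) : x = 0 := by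
  obtain ⟨k, hk, h0⟩ := exists_dotProduct_self hx
  apply h0
  rw [h] at hk
  have : (k : ℂ) = 0 := by linear_combination -hk / 2
  exact_mod_cast this

theorem dotProduct_add_self (x y : V) :
    (x + y) ⬝ᵥ (x + y) = x ⬝ᵥ x + 2 * (x ⬝ᵥ y) + y ⬝ᵥ y := by
  simp only [add_dotProduct, dotProduct_add, dotProduct_comm y x]; ring

theorem dotProduct_sub_self (x y : V) :
    (x - y) ⬝ᵥ (x - y) = x ⬝ᵥ x - 2 * (x ⬝ᵥ y) + y ⬝ᵥ y := by
  simp only [sub_dotProduct, dotProduct_sub, dotProduct_comm y x]; ring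

/-- Polarization of an even form. -/
theorem exists_dotProduct_eq_int {x y : V} (hx : x ∈ E8Lattice) (hy : y ∈ E8Lattice) :
    ∃ k : ℤ, x ⬝ᵥ y = k := by
  obtain ⟨a, ha, -⟩ := exists_dotProduct_self hx
  obtain ⟨b, hb, -⟩ := exists_dotProduct_self hy
  obtain ⟨c, hc, -⟩ := exists_dotProduct_self (E8Lattice.add_mem hx hy)
  rw [dotProduct_add_self] at hc
  exact ⟨c - a - b, by push_cast; linear_combination (hc - ha - hb) / 2⟩

/-- Unit vectors of a common frame coincide up to sign or are orthogonal. -/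
theorem eq_or_eq_neg_or_orthogonal {u v : V} (hu : u ⬝ᵥ u = 1) (hv : v ⬝ᵥ v = 1)
    (ha : u + v ∈ E8Lattice) (hs : u - v ∈ E8Lattice) : v = u ∨ v = -u ∨ u ⬝ᵥ v = 0 := by
  obtain ⟨k, hk, hk0⟩ := exists_dotProduct_self ha
  obtain ⟨l, hl, hl0⟩ := exists_dotProduct_self hs
  rw [dotProduct_add_self, hu, hv] at hk
  rw [dotProduct_sub_self, hu, hv] at hl
  -- The norms `2k` and `2l` of `u + v` and `u - v` add up to 4. If either vanishes, `v = ±u`;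
  -- otherwise both equal 2 and `(u|v) = 0`.
  have hkl : k + l = 2 := by
    have : (k + l : ℂ) = 2 := by linear_combination -(hk + hl) / 2
    exact_mod_cast this
  have : l = 0 ∨ k = 0 ∨ (k = 1 ∧ l = 1) := by omega
  rcases this with h | h | ⟨rfl, rfl⟩
  · left; exact (sub_eq_zero.1 (hl0 h)).symm
  · right; left; exact (neg_eq_of_add_eq_zero_right (hk0 h)).symm
  · right; right; simp at hk; linear_combination hk / 2

/-- The standard unit vectors. -/
abbrev e (i : Fin 8) : V := Pi.single i 1

theorem e_dotProduct (i : Fin 8) (x : V) : e i ⬝ᵥ x = x i := by simp [e]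

theorem dotProduct_e (i : Fin 8) (x : V) : x ⬝ᵥ e i = x i := by simp [e]

theorem e_add_e_mem (i j : Fin 8) : e i + e j ∈ E8Lattice := by
  refine ⟨Or.inl fun k => ⟨(if k = i then 1 else 0) + if k = j then 1 else 0, ?_⟩, 1, ?_⟩
  · simp [e, Pi.single_apply]
  · rw [dotProduct_add, dotProduct_e, dotProduct_e]; simp [phi]; norm_num

theorem two_smul_e_mem (i : Fin 8) : (2 : ℂ) • e i ∈ E8Lattice := by
  rw [two_smul]; exact e_add_e_mem i i

theorem e_sub_e_mem (i j : Fin 8) : e i - e j ∈ E8Lattice := by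
  have := E8Lattice.sub_mem (e_add_e_mem i j) (two_smul_e_mem j)
  convert this using 1; module


/-! ### Lattice isometries and the conjugacy of frames into the standard one. -/

/-- Linear isometries of `V` that preserve the lattice. -/
structure IsLatticeIso (g : V ≃ₗ[ℂ] V) : Prop where
  dot : ∀ x y, g x ⬝ᵥ g y = x ⬝ᵥ y
  mem_iff : ∀ x, g x ∈ E8Lattice ↔ x ∈ E8Lattice

theorem IsLatticeIso.refl : IsLatticeIso (LinearEquiv.refl ℂ V) := ⟨fun _ _ => rfl, fun _ => Iff.rfl⟩

theorem IsLatticeIso.trans {g h : V ≃ₗ[ℂ] V} (hg : IsLatticeIso g) (hh : IsLatticeIso h) :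
    IsLatticeIso (g.trans h) :=
  ⟨fun x y => by simp [hh.dot, hg.dot], fun x => by simp [hh.mem_iff, hg.mem_iff]⟩

theorem IsLatticeIso.symm {g : V ≃ₗ[ℂ] V} (hg : IsLatticeIso g) : IsLatticeIso g.symm :=
  ⟨fun x y => by rw [← hg.dot]; simp, fun x => by rw [← hg.mem_iff]; simp⟩

/-- The reflection in a root. -/
theorem exists_reflection {r : V} (hr : r ∈ E8Lattice) (h2 : r ⬝ᵥ r = 2) :
    ∃ g : V ≃ₗ[ℂ] V, IsLatticeIso g ∧ ∀ x, g x = x - (x ⬝ᵥ r) • r := by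
  let f : V →ₗ[ℂ] V :=
    { toFun := fun x => x - (x ⬝ᵥ r) • r
      map_add' := fun x y => by rw [add_dotProduct]; module
      map_smul' := fun c x => by rw [smul_dotProduct, smul_eq_mul, RingHom.id_apply]; module }
  have hf : Function.Involutive f := fun x => by
    change (x - (x ⬝ᵥ r) • r) - ((x - (x ⬝ᵥ r) • r) ⬝ᵥ r) • r = x
    rw [sub_dotProduct, smul_dotProduct, h2, smul_eq_mul]; module
  have hmem : ∀ x ∈ E8Lattice, f x ∈ E8Lattice := fun x hx => by
    obtain ⟨k, hk⟩ := exists_dotProduct_eq_int hx hr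
    change x - (x ⬝ᵥ r) • r ∈ E8Lattice
    rw [hk]
    exact E8Lattice.sub_mem hx (E8Lattice.intCast_smul_mem hr k)
  refine ⟨LinearEquiv.ofInvolutive f hf, ⟨fun x y => ?_, fun x => ⟨fun h => ?_, hmem x⟩⟩,
    fun x => rfl⟩
  · change (x - (x ⬝ᵥ r) • r) ⬝ᵥ (y - (y ⬝ᵥ r) • r) = _
    simp only [sub_dotProduct, dotProduct_sub, smul_dotProduct, dotProduct_smul, h2, smul_eq_mul,
      dotProduct_comm r y]
    ring
  · have := hmem _ h
    exact (hf x) ▸ this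

/-- Two vectors of norm 4 with inner product 3 are exchanged by a reflection. -/
theorem exists_iso_map_eq {v w : V} (hv : v ∈ E8Lattice) (hw : w ∈ E8Lattice)
    (hv4 : v ⬝ᵥ v = 4) (hw4 : w ⬝ᵥ w = 4) (h : v ⬝ᵥ w = 3) :
    ∃ g : V ≃ₗ[ℂ] V, IsLatticeIso g ∧ g v = w := by
  obtain ⟨g, hg, hgx⟩ := exists_reflection (E8Lattice.sub_mem hv hw)
    (by rw [dotProduct_sub_self, hv4, hw4, h]; norm_num)
  refine ⟨g, hg, ?_⟩
  rw [hgx, dotProduct_sub, hv4, h]; norm_num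

/-- Eight coordinates of square at least `1/4` and total norm 4 force exactly one coordinate `±3/2`.
Then `v` pairs to 3 with `±2 e i`, also of norm 4, and a reflection carries one to the other. -/
theorem exists_iso_of_half {v : V} (hv : v ∈ E8Lattice) (h4 : v ⬝ᵥ v = 4)
    (hh : ∀ i, ∃ m : ℤ, v i = phi i + m) :
    ∃ g : V ≃ₗ[ℂ] V, IsLatticeIso g ∧ ∃ (i : Fin 8) (m : ℤ), g v = (2 * m : ℂ) • e i := by
  choose m hm using hh
  have hs : ∑ i, (m i ^ 2 + m i) = 2 := by
    have : (∑ i, ((m i : ℂ) ^ 2 + m i)) = 2 := by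
      have e0 : ∀ i, v i * v i = 1 / 4 + ((m i : ℂ) ^ 2 + m i) := fun i => by
        simp only [hm, phi]; ring
      simp only [dotProduct, e0] at h4
      rw [Finset.sum_add_distrib] at h4
      simp at h4
      linear_combination h4
    exact_mod_cast this
  obtain ⟨i, hi⟩ : ∃ i, m i ^ 2 + m i ≠ 0 := by
    by_contra! hc
    simp [hc] at hs
  have hle : m i ^ 2 + m i ≤ 2 := by
    rw [← hs]
    exact Finset.single_le_sum (f := fun i => m i ^ 2 + m i) (fun j _ => by
      change 0 ≤ m j ^ 2 + m j
      rcases le_or_gt 0 (m j) with h | h <;> nlinarith) (Finset.mem_univ i)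
  have hmi : m i = 1 ∨ m i = -2 := by
    have h1 : m i ≤ 1 := by nlinarith
    have h2 : -2 ≤ m i := by nlinarith
    interval_cases m i <;> simp at hi ⊢
  obtain ⟨ε, hε, hvi⟩ : ∃ ε : ℤ, ε * ε = 1 ∧ v i = 3 / 2 * ε := by
    rcases hmi with h | h
    · exact ⟨1, by norm_num, by rw [hm, h, phi]; norm_num⟩
    · exact ⟨-1, by norm_num, by rw [hm, h, phi]; norm_num⟩
  have hεc : (ε : ℂ) * ε = 1 := by exact_mod_cast hε
  have hw : (2 * ε : ℂ) • e i ∈ E8Lattice := by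
    rw [mul_comm, mul_smul]; exact E8Lattice.intCast_smul_mem (two_smul_e_mem i) ε
  obtain ⟨g, hg, hgv⟩ := exists_iso_map_eq hv hw h4
    (by rw [smul_dotProduct, dotProduct_smul, dotProduct_e]; simp; linear_combination 4 * hεc)
    (by rw [dotProduct_smul, dotProduct_e, hvi, smul_eq_mul]; linear_combination 3 * hεc)
  exact ⟨g, hg, i, ε, hgv⟩

/-- Either `v = ±2 e i`, or `v` has four coordinates `±1`. In the second case a root `r` with all
coordinates `±1/2` and `(v|r) = 1` is found; its reflection sends `v` to the half-integral vector `v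
- r`, to which `exists_iso_of_half` applies. -/
theorem exists_iso_of_int {v : V} (hv : v ∈ E8Lattice) (h4 : v ⬝ᵥ v = 4)
    (hh : ∀ i, ∃ m : ℤ, v i = m) :
    ∃ g : V ≃ₗ[ℂ] V, IsLatticeIso g ∧ ∃ (i : Fin 8) (m : ℤ), g v = (2 * m : ℂ) • e i := by
  choose m hm using hh
  have hs : ∑ i, m i ^ 2 = 4 := by
    have : (∑ i, (m i : ℂ) ^ 2) = 4 := by
      simp only [dotProduct, hm] at h4
      simpa [sq] using h4
    exact_mod_cast this
  have hle : ∀ i, m i ^ 2 ≤ 4 := fun i => by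
    rw [← hs]
    exact Finset.single_le_sum (f := fun i => m i ^ 2) (fun j _ => sq_nonneg _) (Finset.mem_univ i)
  by_cases h2 : ∃ i, m i ^ 2 = 4
  · obtain ⟨i, hi⟩ := h2
    refine ⟨_, IsLatticeIso.refl, i, m i / 2, ?_⟩
    have hq : 2 * (m i / 2) = m i := by
      have h1 : m i ≤ 2 := by nlinarith
      have h2 : -2 ≤ m i := by nlinarith
      interval_cases m i <;> simp at hi ⊢
    have hqc : (2 * ((m i / 2 : ℤ) : ℂ)) = m i := by exact_mod_cast hq
    rw [hqc]
    ext j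
    by_cases hj : j = i
    · subst hj; simp [hm]
    · have h0 : m j ^ 2 = 0 := by
        have := Finset.add_le_sum (f := fun i => m i ^ 2) (s := Finset.univ)
          (fun j _ => sq_nonneg _) (Finset.mem_univ i) (Finset.mem_univ j) (Ne.symm hj)
        rw [hs] at this
        nlinarith [sq_nonneg (m j)]
      simp [hm, hj, pow_eq_zero_iff] at h0 ⊢
      exact_mod_cast h0
  · have h01 : ∀ i, m i = -1 ∨ m i = 0 ∨ m i = 1 := fun i => by
      have := hle i
      have h1 : m i ≤ 2 := by nlinarith
      have h3 : -2 ≤ m i := by nlinarith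
      have h4 : m i ^ 2 ≠ 4 := fun h => h2 ⟨i, h⟩
      generalize m i = t at *
      interval_cases t <;> simp at h4 ⊢
    obtain ⟨q, hq⟩ := even_sum_of_mem hv.2 hm
    obtain ⟨i₀, hi₀⟩ : ∃ i, m i ≠ 0 := by
      by_contra! hc
      simp [hc] at hs
    obtain ⟨k₀, hk₀⟩ : ∃ i, m i = 0 := by
      by_contra! hc
      have : ∀ i, m i ^ 2 = 1 := fun i => by rcases h01 i with h | h | h <;> simp_all
      simp [this] at hs
    have hik : k₀ ≠ i₀ := fun h => hi₀ (h ▸ hk₀)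
    -- `r` has all coordinates `± 1/2`, with `p` fixing its parity
    obtain ⟨p, hp01, k, hpk⟩ : ∃ p : ℤ, (p = 0 ∨ p = 1) ∧ ∃ k, q + 2 - m i₀ - p = k + k := by
      rcases Int.even_or_odd' (q + 2 - m i₀) with ⟨k, hk | hk⟩
      · exact ⟨0, Or.inl rfl, k, by omega⟩
      · exact ⟨1, Or.inr rfl, k, by omega⟩
    -- On the support of `m` the signs follow `m`, except at `i₀`: the reversal there lowers `(v|r)`
    -- from 2 to 1. At `k₀`, off the support, the sign can be changed without affecting `(v|r)`.
    let r : V := fun i => ((m i : ℂ) + (1 - (m i : ℂ) ^ 2)) / 2 - (if i = i₀ then (m i₀ : ℂ) else 0) -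
      if i = k₀ then (p : ℂ) else 0
    have hr4 : ∀ i, r i * r i = 1 / 4 := fun i => by
      have hk₀' : ((m k₀ : ℤ) : ℂ) = 0 := by exact_mod_cast hk₀
      by_cases h1 : i = i₀
      · subst h1
        have : ((m i : ℤ) : ℂ) ^ 2 = 1 := by
          rcases h01 i with h | h | h
          · simp [h]
          · exact absurd h hi₀
          · simp [h]
        simp only [r, if_true, if_neg hik.symm, this]
        linear_combination this / 4
      · by_cases h2 : i = k₀
        · subst h2
          simp only [r, if_true, if_neg h1, hk₀']
          rcases hp01 with rfl | rfl <;> norm_num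
        · simp only [r, if_neg h1, if_neg h2]
          rcases h01 i with h | h | h <;> (simp [h]; try norm_num)
    have hrh : ∀ i, ∃ l : ℤ, r i = phi i + l := fun i => by
      have : (r i - 1 / 2) * (r i + 1 / 2) = 0 := by linear_combination hr4 i
      rcases mul_eq_zero.1 this with h | h
      · exact ⟨0, by simp only [phi]; push_cast; linear_combination h⟩
      · exact ⟨-1, by simp only [phi]; push_cast; linear_combination h⟩
    have hsc : (∑ i, (m i : ℂ) ^ 2) = 4 := by exact_mod_cast hs
    have hqc : (∑ i, (m i : ℂ)) = q + q := by exact_mod_cast hq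
    have hr : r ∈ E8Lattice := by
      refine ⟨Or.inr hrh, k, ?_⟩
      rw [phi_dotProduct_eq_sum]
      simp only [r, Finset.sum_sub_distrib, ← Finset.sum_div, Finset.sum_add_distrib, hsc, hqc,
        Finset.sum_ite_eq', Finset.mem_univ, if_true]
      have : (q + 2 - m i₀ - p : ℂ) = k + k := by exact_mod_cast hpk
      simp
      linear_combination this / 2
    have hr2 : r ⬝ᵥ r = 2 := by simp [dotProduct, hr4]; norm_num
    have hvr : v ⬝ᵥ r = 1 := by
      have : ∀ i, v i * r i = ((m i : ℂ) ^ 2) / 2 - (if i = i₀ then (m i₀ : ℂ) ^ 2 else 0) := fun i => by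
        have h3 : (m i : ℂ) ^ 3 = m i := by rcases h01 i with h | h | h <;> (simp [h]; try norm_num)
        have hk₀' : ((m k₀ : ℤ) : ℂ) = 0 := by exact_mod_cast hk₀
        rw [hm]
        by_cases h1 : i = i₀
        · subst h1
          simp only [r, if_true, if_neg hik.symm]
          linear_combination -h3 / 2
        · by_cases h2 : i = k₀
          · subst h2
            simp only [r, if_true, if_neg h1, hk₀']; simp
          · simp only [r, if_neg h1, if_neg h2]
            linear_combination -h3 / 2
      simp only [dotProduct, this, Finset.sum_sub_distrib, ← Finset.sum_div, hsc,
        Finset.sum_ite_eq', Finset.mem_univ, if_true]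
      have : ((m i₀ : ℤ) : ℂ) ^ 2 = 1 := by
        rcases h01 i₀ with h | h | h
        · simp [h]
        · exact absurd h hi₀
        · simp [h]
      rw [this]; norm_num
    obtain ⟨g, hg, hgx⟩ := exists_reflection hr hr2
    have hgv : g v = v - r := by rw [hgx, hvr, one_smul]
    obtain ⟨g', hg', i, l, hl⟩ := exists_iso_of_half (v := g v) ((hg.mem_iff v).2 hv)
      (by rw [hg.dot, h4]) (fun i => by
        obtain ⟨l, hl⟩ := hrh i
        refine ⟨m i - l - 1, ?_⟩
        rw [hgv, Pi.sub_apply, hm, hl]; simp only [phi]; push_cast; ring)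
    exact ⟨g.trans g', hg.trans hg', i, l, by simpa using hl⟩

/-- Every frame is mapped into the standard frame by an isometry of the lattice. -/
theorem IsCFrame.exists_iso {a : Fin 3 → V} (ha : IsCFrame a) :
    ∃ g : V ≃ₗ[ℂ] V, IsLatticeIso g ∧ ∃ (k : Fin 3 → Fin 8) (ε : Fin 3 → ℤ),
      (∀ i, ε i = 1 ∨ ε i = -1) ∧ ∀ i, g (a i) = (ε i : ℂ) • e (k i) := by
  have h0 := ha.two_smul_mem 0
  have h4 : ((2 : ℂ) • a 0) ⬝ᵥ ((2 : ℂ) • a 0) = 4 := by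
    rw [smul_dotProduct, dotProduct_smul, ha.orthonormal]; norm_num
  obtain ⟨g, hg, i, m, hm⟩ : ∃ g : V ≃ₗ[ℂ] V, IsLatticeIso g ∧
      ∃ (i : Fin 8) (m : ℤ), g ((2 : ℂ) • a 0) = (2 * m : ℂ) • e i := by
    rcases h0.1 with h | h
    · exact exists_iso_of_int h0 h4 h
    · exact exists_iso_of_half h0 h4 h
  have hga : g (a 0) = (m : ℂ) • e i := by
    rw [map_smul, mul_smul] at hm
    exact smul_right_injective V (two_ne_zero (α := ℂ)) hm
  have hm1 : m = 1 ∨ m = -1 := by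
    have h1 := hg.dot (a 0) (a 0)
    rw [hga, ha.orthonormal, smul_dotProduct, dotProduct_smul, dotProduct_e] at h1
    simp at h1
    have : m * m = 1 := by exact_mod_cast h1
    exact mul_self_eq_one_iff.1 this
  have hother : ∀ j : Fin 3, 0 < j → ∃ (k : Fin 8) (η : ℤ),
      (η = 1 ∨ η = -1) ∧ g (a j) = (η : ℂ) • e k := by
    intro j hj
    have hu : g (a j) ⬝ᵥ g (a j) = 1 := by rw [hg.dot, ha.orthonormal]; simp
    have hui : g (a j) i = 0 := by
      have h1 := hg.dot (a 0) (a j)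
      rw [hga, ha.orthonormal, if_neg hj.ne, smul_dotProduct, e_dotProduct, smul_eq_mul] at h1
      rcases mul_eq_zero.1 h1 with h | h
      · have : m = 0 := by exact_mod_cast h
        omega
      · exact h
    have hmem : g (a 0) + g (a j) ∈ E8Lattice := by
      rw [← map_add, hg.mem_iff]; exact ha.add_mem 0 j hj
    -- The `i`-th coordinate of `g (a 0) + g (a j)` is the integer `m`, which excludes the
    -- half-integral coset. An integral vector of norm 1 is a signed `e k`.
    have hint : ∀ l, ∃ t : ℤ, g (a j) l = t := by
      rcases hmem.1 with h | h
      · intro l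
        obtain ⟨t, ht⟩ := h l
        rw [hga] at ht
        refine ⟨t - if l = i then m else 0, ?_⟩
        push_cast
        rw [← ht]
        simp [e, Pi.single_apply]
      · obtain ⟨t, ht⟩ := h i
        rw [hga, Pi.add_apply, hui] at ht
        simp [phi] at ht
        have : (2 * m : ℂ) = 1 + 2 * t := by linear_combination 2 * ht
        have : 2 * m = 1 + 2 * t := by exact_mod_cast this
        omega
    choose t ht using hint
    have hs : ∑ l, t l ^ 2 = 1 := by
      have : (∑ l, (t l : ℂ) ^ 2) = 1 := by
        simp only [dotProduct, ht] at hu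
        simpa [sq] using hu
      exact_mod_cast this
    obtain ⟨k, hk⟩ : ∃ k, t k ≠ 0 := by
      by_contra! hc
      simp [hc] at hs
    have hk1 : 0 < t k ^ 2 := by positivity
    have hz : ∀ l, l ≠ k → t l = 0 := fun l hl => by
      have := Finset.add_le_sum (f := fun i => t i ^ 2) (s := Finset.univ)
        (fun j _ => sq_nonneg _) (Finset.mem_univ k) (Finset.mem_univ l) (Ne.symm hl)
      rw [hs] at this
      exact pow_eq_zero_iff (two_ne_zero) |>.1 (le_antisymm (by omega) (sq_nonneg (t l)))
    refine ⟨k, t k, ?_, ?_⟩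
    · have : t k ^ 2 = 1 := by
        rw [← hs]
        exact (Finset.sum_eq_single (f := fun l => t l ^ 2) k
          (fun l _ hl => by simp [hz l hl]) (by simp)).symm
      exact sq_eq_one_iff.1 this
    · ext l
      by_cases hl : l = k
      · subst hl; simp [ht]
      · simp [ht, hz l hl, hl]
  have hall : ∀ j : Fin 3, ∃ (k : Fin 8) (η : ℤ),
      (η = 1 ∨ η = -1) ∧ g (a j) = (η : ℂ) • e k := fun j => by
    by_cases hj : j = 0
    · subst hj; exact ⟨i, m, hm1, hga⟩
    · exact hother j (Fin.pos_iff_ne_zero.2 hj)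
  choose k ε hε hk using hall
  exact ⟨g, hg, k, ε, hε, hk⟩


/-! ### Extension of a frame by a fourth vector. -/

theorem signed_add_signed_mem {ε η : ℤ} (hε : ε = 1 ∨ ε = -1) (hη : η = 1 ∨ η = -1) (i j : Fin 8) :
    (ε : ℂ) • e i + (η : ℂ) • e j ∈ E8Lattice := by
  rcases hε with rfl | rfl <;> rcases hη with rfl | rfl <;> push_cast
  · simpa using e_add_e_mem i j
  · convert e_sub_e_mem i j using 1; module
  · convert e_sub_e_mem j i using 1; module
  · convert E8Lattice.neg_mem (e_add_e_mem i j) using 1; module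

theorem signed_sub_signed_mem {ε η : ℤ} (hε : ε = 1 ∨ ε = -1) (hη : η = 1 ∨ η = -1) (i j : Fin 8) :
    (ε : ℂ) • e i - (η : ℂ) • e j ∈ E8Lattice := by
  have := signed_add_signed_mem hε (η := -η) (by omega) i j
  convert this using 1; push_cast; module

/-- `b` is a further member of the frame spanned by the `a i`. -/
structure ExtendsFrame (a : Fin 3 → V) (b : V) : Prop where
  norm : b ⬝ᵥ b = 1
  orth : ∀ i, a i ⬝ᵥ b = 0
  add_mem : ∀ i, a i + b ∈ E8Lattice
  sub_mem : ∀ i, a i - b ∈ E8Lattice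

theorem ExtendsFrame.of_iso {a : Fin 3 → V} {g : V ≃ₗ[ℂ] V} (hg : IsLatticeIso g)
    {k : Fin 3 → Fin 8} {ε : Fin 3 → ℤ} (hε : ∀ i, ε i = 1 ∨ ε i = -1)
    (hga : ∀ i, g (a i) = (ε i : ℂ) • e (k i)) {r : Fin 8} (hr : ∀ i, k i ≠ r) {η : ℤ}
    (hη : η = 1 ∨ η = -1) : ExtendsFrame a (g.symm ((η : ℂ) • e r)) where
  norm := by
    rw [← hg.dot, g.apply_symm_apply, smul_dotProduct, dotProduct_smul, dotProduct_e]
    rcases hη with rfl | rfl <;> simp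
  orth i := by
    rw [← hg.dot, g.apply_symm_apply, hga, smul_dotProduct, dotProduct_smul, dotProduct_e]
    simp [(hr i).symm]
  add_mem i := by
    rw [← hg.mem_iff, map_add, g.apply_symm_apply, hga]
    exact signed_add_signed_mem (hε i) hη _ _
  sub_mem i := by
    rw [← hg.mem_iff, map_sub, g.apply_symm_apply, hga]
    exact signed_sub_signed_mem (hε i) hη _ _

theorem exists_ne_three (k : Fin 3 → Fin 8) : ∃ r, ∀ i, k i ≠ r := by
  have : ¬ Function.Surjective k := fun h => by
    have := Fintype.card_le_of_surjective k h
    simp at this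
  simpa [Function.Surjective] using this

/-- Since `φ` lies in the span of the frame, every extension is orthogonal to it. -/
theorem IsCFrame.exists_extends_of_one_one {a : Fin 3 → V} (ha : IsCFrame a)
    (h : phi = a 0 + a 1) : ∃ b, ExtendsFrame a b ∧ phi ⬝ᵥ b = 0 := by
  obtain ⟨g, hg, k, ε, hε, hga⟩ := ha.exists_iso
  obtain ⟨r, hr⟩ := exists_ne_three k
  have hb := ExtendsFrame.of_iso hg hε hga hr (Or.inl rfl)
  exact ⟨_, hb, by rw [h, add_dotProduct, hb.orth, hb.orth, add_zero]⟩

/-- Eight squares of at least `1/4` already exhaust the norm 2. -/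
theorem dotProduct_self_eq_two_of_half {x : V} (h2 : x ⬝ᵥ x = 2)
    (hx : ∀ i, ∃ m : ℤ, x i = phi i + m) (i : Fin 8) : x i = 1 / 2 ∨ x i = -1 / 2 := by
  choose m hm using hx
  have hs : ∑ i, (m i ^ 2 + m i) = 0 := by
    have : (∑ i, ((m i : ℂ) ^ 2 + m i)) = 0 := by
      have e0 : ∀ i, x i * x i = 1 / 4 + ((m i : ℂ) ^ 2 + m i) := fun i => by
        simp only [hm, phi]; ring
      simp only [dotProduct, e0] at h2
      rw [Finset.sum_add_distrib] at h2
      simp at h2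
      linear_combination h2
    exact_mod_cast this
  rw [Finset.sum_eq_zero_iff_of_nonneg fun j _ => by
    rcases le_or_gt 0 (m j) with h | h <;> nlinarith] at hs
  have h0 : m i * (m i + 1) = 0 := by linear_combination hs i (Finset.mem_univ i)
  rcases mul_eq_zero.1 h0 with h | h
  · left; simp [hm, h, phi]
  · right; rw [hm, show m i = -1 by omega, phi]; norm_num

/-- In standard coordinates `g φ` has a half-integral entry, so it is a root with all entries
`±1/2`. Any unused basis vector, with the right sign, will do. -/
theorem IsCFrame.exists_extends_of_half {a : Fin 3 → V} (ha : IsCFrame a)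
    (h : ∀ i, phi ⬝ᵥ a i = 1 / 2) : ∃ b, ExtendsFrame a b ∧ phi ⬝ᵥ b = 1 / 2 := by
  obtain ⟨g, hg, k, ε, hε, hga⟩ := ha.exists_iso
  obtain ⟨r, hr⟩ := exists_ne_three k
  have hm : g phi ∈ E8Lattice := (hg.mem_iff _).2 phi_mem
  have h0 : g phi (k 0) * ε 0 = 1 / 2 := by
    rw [← h 0, ← hg.dot, hga, dotProduct_smul, dotProduct_e, smul_eq_mul, mul_comm]
  have hhalf : ∀ i, ∃ m : ℤ, g phi i = phi i + m := by
    rcases hm.1 with h' | h'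
    · obtain ⟨m, hm⟩ := h' (k 0)
      rw [hm] at h0
      have : (2 * (m * ε 0) : ℂ) = 1 := by linear_combination 2 * h0
      have : 2 * (m * ε 0) = 1 := by exact_mod_cast this
      omega
    · exact h'
  have hpp : g phi ⬝ᵥ g phi = 2 := by rw [hg.dot, phi_dotProduct_phi]
  have key : ∀ η : ℤ, phi ⬝ᵥ g.symm ((η : ℂ) • e r) = η * g phi r := fun η => by
    rw [← hg.dot, g.apply_symm_apply, dotProduct_smul, dotProduct_e, smul_eq_mul]
  rcases dotProduct_self_eq_two_of_half hpp hhalf r with h1 | h1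
  · exact ⟨_, ExtendsFrame.of_iso hg hε hga hr (Or.inl rfl), by rw [key, h1]; norm_num⟩
  · exact ⟨_, ExtendsFrame.of_iso hg hε hga hr (Or.inr rfl), by rw [key, h1]; norm_num⟩

/-- The data needed for (II₀) at the next level: `l` and `l'` are weights of all three roots `a i -
b` at once, and each of them gives a frame `l/2 - a i` of type (I). In standard coordinates `g φ` is
an integral root with two entries `±1`, both away from the frame, which leaves three free positions
`r`, `t`, `u`. There `b` becomes `-e r`, while `l` and `l'` are half-integral roots that differ by a
sign change at `t` and `u`. -/
theorem IsCFrame.exists_extends_of_zero {a : Fin 3 → V} (ha : IsCFrame a)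
    (h : ∀ i, phi ⬝ᵥ a i = 0) : ∃ b l l' : V, ExtendsFrame a b ∧ phi ⬝ᵥ b = 0 ∧
      l ∈ E8Lattice ∧ l' ∈ E8Lattice ∧ l ⬝ᵥ l = 2 ∧ l' ⬝ᵥ l' = 2 ∧ phi ⬝ᵥ l = 1 ∧ phi ⬝ᵥ l' = 1 ∧
      (∀ i, a i ⬝ᵥ l = 1 / 2) ∧ (∀ i, a i ⬝ᵥ l' = 1 / 2) ∧ b ⬝ᵥ l = -1 / 2 ∧ b ⬝ᵥ l' = -1 / 2 ∧
      l + l' = phi + a 0 + a 1 + a 2 - b := by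
  obtain ⟨g, hg, k, ε, hε, hga⟩ := ha.exists_iso
  have hm : g phi ∈ E8Lattice := (hg.mem_iff _).2 phi_mem
  have hε0 : ∀ i, (ε i : ℂ) * ε i = 1 := fun i => by rcases hε i with h | h <;> simp [h]
  have h0 : ∀ i, g phi (k i) = 0 := fun i => by
    have : (ε i : ℂ) * g phi (k i) = 0 := by
      rw [← h i, ← hg.dot, hga, dotProduct_smul, dotProduct_e, smul_eq_mul]
    linear_combination (ε i : ℂ) * this - g phi (k i) * hε0 i
  have hint : ∀ i, ∃ m : ℤ, g phi i = m := by
    rcases hm.1 with h' | h'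
    · exact h'
    · obtain ⟨m, hm⟩ := h' (k 0)
      rw [h0, phi] at hm
      have : (2 * m : ℂ) = -1 := by linear_combination -2 * hm
      have : 2 * m = -1 := by exact_mod_cast this
      omega
  have hpp : g phi ⬝ᵥ g phi = 2 := by rw [hg.dot, phi_dotProduct_phi]
  choose m hmi using hint
  have hs : ∑ i, m i ^ 2 = 2 := by
    have : (∑ i, (m i : ℂ) ^ 2) = 2 := by
      simp only [dotProduct, hmi] at hpp
      simpa [sq] using hpp
    exact_mod_cast this
  have hsq : ∀ i, m i ≠ 0 → m i ^ 2 = 1 := fun i hi => by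
    have : m i ^ 2 ≤ 2 := by
      rw [← hs]
      exact Finset.single_le_sum (f := fun i => m i ^ 2) (fun j _ => sq_nonneg _) (Finset.mem_univ i)
    have h1 : m i ≤ 1 := by nlinarith
    have h2 : -1 ≤ m i := by nlinarith
    generalize m i = t at *
    interval_cases t <;> simp at hi ⊢
  have hk0 : ∀ i, m (k i) = 0 := fun i => by
    have := h0 i; rw [hmi] at this; exact_mod_cast this
  have hkinj : Function.Injective k := fun i j hij => by
    by_contra hne
    have h1 := hg.dot (a i) (a j)
    rw [hga, hga, hij, ha.orthonormal, if_neg hne, smul_dotProduct, dotProduct_smul,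
      dotProduct_e] at h1
    rcases hε i with h2 | h2 <;> rcases hε j with h3 | h3 <;> simp [h2, h3] at h1
  -- the support of `g phi`
  let S : Finset (Fin 8) := Finset.univ.filter fun i => m i ≠ 0
  have hS : S.card = 2 := by
    have : ∑ i, m i ^ 2 = ∑ i, if m i ≠ 0 then (1 : ℤ) else 0 :=
      Finset.sum_congr rfl fun i _ => by
        by_cases hi : m i = 0
        · simp [hi]
        · simp [hi, hsq i hi]
    rw [this, Finset.sum_boole] at hs
    exact_mod_cast hs
  let K : Finset (Fin 8) := Finset.univ.image k
  have hK : K.card = 3 := by rw [Finset.card_image_of_injective _ hkinj]; simp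
  obtain ⟨r, t, u, hr, ht, hu, hrt, hru, htu⟩ := Finset.two_lt_card_iff.1
    (show 2 < (S ∪ K)ᶜ.card by
      rw [Finset.card_compl]
      have := Finset.card_union_le S K
      simp; omega)
  have hSK : Disjoint S K := by
    rw [Finset.disjoint_left]
    intro i hi hiK
    obtain ⟨j, -, rfl⟩ := Finset.mem_image.1 hiK
    exact (Finset.mem_filter.1 hi).2 (hk0 j)
  have hall : ∀ i, i ∈ S ∨ i ∈ K ∨ i = r ∨ i = t ∨ i = u := by
    have h1 : (({r, t, u} : Finset (Fin 8)) : Finset (Fin 8)) = (S ∪ K)ᶜ := by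
      apply Finset.eq_of_subset_of_card_le
      · intro x hx
        simp only [Finset.mem_insert, Finset.mem_singleton] at hx
        rcases hx with rfl | rfl | rfl <;> assumption
      · rw [Finset.card_compl, Finset.card_union_of_disjoint hSK, hS, hK,
          Finset.card_eq_three.2 ⟨r, t, u, hrt, hru, htu, rfl⟩]
        simp
    intro i
    by_cases hi : i ∈ S ∪ K
    · rcases Finset.mem_union.1 hi with h | h
      · exact Or.inl h
      · exact Or.inr (Or.inl h)
    · rw [← Finset.mem_compl, ← h1] at hi
      simp only [Finset.mem_insert, Finset.mem_singleton] at hi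
      exact Or.inr (Or.inr hi)
  have hn : ∀ {x}, x ∈ (S ∪ K)ᶜ → m x = 0 ∧ ∀ i, k i ≠ x := fun {x} hx => by
    rw [Finset.mem_compl, Finset.mem_union, not_or] at hx
    refine ⟨by simpa [S] using hx.1, fun i hi => hx.2 (Finset.mem_image.2 ⟨i, by simp, hi⟩)⟩
  obtain ⟨hr0, hrk⟩ := hn hr
  obtain ⟨ht0, htk⟩ := hn ht
  obtain ⟨hu0, huk⟩ := hn hu
  obtain ⟨q, hq⟩ := even_sum_of_mem hm.2 hmi
  -- The sign `η` at position `u` makes the coordinate sum of the doubled vector divisible by 4, so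
  -- that its half pairs integrally with `φ`.
  obtain ⟨η, hη, w, hw⟩ : ∃ η : ℤ, (η = 1 ∨ η = -1) ∧
      ∃ w, q + q + (ε 0 + ε 1 + ε 2) + 2 + η = 4 * w := by
    have : ε 0 + ε 1 + ε 2 = 2 * ((ε 0 + ε 1 + ε 2 - 1) / 2) + 1 := by
      have := hε 0; have := hε 1; have := hε 2
      omega
    rcases Int.even_or_odd' (q + (ε 0 + ε 1 + ε 2 - 1) / 2) with ⟨w, hw | hw⟩
    · exact ⟨1, Or.inl rfl, w + 1, by omega⟩
    · exact ⟨-1, Or.inr rfl, w + 1, by omega⟩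
  have hη0 : (η : ℂ) * η = 1 := by rcases hη with h | h <;> simp [h]
  let n : Fin 8 → ℤ := fun i => m i + (ε 0 * (if i = k 0 then 1 else 0) +
    ε 1 * (if i = k 1 then 1 else 0) + ε 2 * (if i = k 2 then 1 else 0)) +
    (if i = r then 1 else 0) + (if i = t then 1 else 0) + η * (if i = u then 1 else 0)
  have h01 : k 0 ≠ k 1 := fun h => by simpa using hkinj h
  have h02 : k 0 ≠ k 2 := fun h => by simpa using hkinj h
  have h12 : k 1 ≠ k 2 := fun h => by simpa using hkinj h
  have hodd : ∀ i, ∃ p, n i = 1 + 2 * p := fun i => by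
    have hpm : ∀ {z : ℤ}, (z = 1 ∨ z = -1) → ∃ p, z = 1 + 2 * p := fun {z} hz => by
      rcases hz with rfl | rfl
      · exact ⟨0, rfl⟩
      · exact ⟨-1, rfl⟩
    rcases hall i with hi | hi | rfl | rfl | rfl
    · have hmi : m i ≠ 0 := (Finset.mem_filter.1 hi).2
      have hne : ∀ {j}, m j = 0 → i ≠ j := fun h1 h2 => hmi (h2 ▸ h1)
      have : n i = m i := by
        simp [n, hne (hk0 0), hne (hk0 1), hne (hk0 2), hne hr0, hne ht0, hne hu0]
      rw [this]
      exact hpm (sq_eq_one_iff.1 (hsq i hmi))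
    · obtain ⟨j, -, rfl⟩ := Finset.mem_image.1 hi
      have : n (k j) = ε j := by
        fin_cases j
        · simp [n, hk0, hrk, htk, huk, h01, h02]
        · simp [n, hk0, hrk, htk, huk, h01.symm, h12]
        · simp [n, hk0, hrk, htk, huk, h02.symm, h12.symm]
      rw [this]
      exact hpm (hε j)
    · exact ⟨0, by simp [n, hr0, (hrk _).symm, hrt, hru]⟩
    · exact ⟨0, by simp [n, ht0, (htk _).symm, hrt.symm, htu]⟩
    · have : n i = η := by simp [n, hu0, (huk _).symm, hru.symm, htu.symm]
      rw [this]
      exact hpm hη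
  -- The supports of the summands partition the eight positions, so every coordinate of `y` is
  -- `±1/2`.
  let y : V := (1 / 2 : ℂ) • (g phi + g (a 0) + g (a 1) + g (a 2) + e r + e t + (η : ℂ) • e u)
  have hyn : ∀ i, y i = n i / 2 := fun i => by
    simp only [y, hga, n, Pi.smul_apply, Pi.add_apply, hmi, e, Pi.single_apply, smul_eq_mul]
    push_cast
    ring
  have hsumn : (∑ i, n i) = 4 * w := by
    simp only [n, Finset.sum_add_distrib, ← Finset.mul_sum, Finset.sum_ite_eq', Finset.mem_univ,
      if_true, hq]
    linear_combination hw
  have hy : y ∈ E8Lattice := by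
    refine ⟨Or.inr fun i => ?_, w, ?_⟩
    · obtain ⟨p, hp⟩ := hodd i
      exact ⟨p, by rw [hyn, hp, phi]; push_cast; ring⟩
    · rw [phi_dotProduct_eq_sum]
      simp only [hyn, ← Finset.sum_div]
      have : (∑ i, (n i : ℂ)) = 4 * w := by exact_mod_cast hsumn
      rw [this]; ring
  have hηu : e t + (η : ℂ) • e u ∈ E8Lattice := by
    simpa using signed_add_signed_mem (Or.inl rfl) hη t u
  let y' : V := y - (e t + (η : ℂ) • e u)
  have hy' : y' ∈ E8Lattice := E8Lattice.sub_mem hy hηu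
  have hphi : ∀ i, (g phi) ⬝ᵥ e i = m i := fun i => by rw [dotProduct_e, hmi]
  have haa : ∀ i j, g (a i) ⬝ᵥ g (a j) = if i = j then 1 else 0 := fun i j => by
    rw [hg.dot, ha.orthonormal]
  have hae : ∀ i j, (∀ i, k i ≠ j) → g (a i) ⬝ᵥ e j = 0 := fun i j hj => by
    rw [dotProduct_e, hga]; simp [(hj i).symm]
  have hphia : ∀ i, g phi ⬝ᵥ g (a i) = 0 := fun i => by rw [hg.dot, h]
  have hee : ∀ i j, e i ⬝ᵥ e j = if j = i then 1 else 0 := fun i j => by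
    rw [e_dotProduct]; simp [e, Pi.single_apply, eq_comm]
  have c1 : ∀ i, g (a i) ⬝ᵥ g phi = 0 := fun i => by rw [dotProduct_comm, hphia]
  have c2 : ∀ i, e i ⬝ᵥ g phi = m i := fun i => by rw [dotProduct_comm, hphi]
  have c3 : ∀ i j, (∀ i, k i ≠ j) → e j ⬝ᵥ g (a i) = 0 := fun i j hj => by
    rw [dotProduct_comm, hae i j hj]
  have key : ∀ x z, g.symm x ⬝ᵥ z = x ⬝ᵥ g z := fun x z => by rw [← hg.dot]; simp
  have key' : ∀ x z, z ⬝ᵥ g.symm x = g z ⬝ᵥ x := fun x z => by rw [← hg.dot]; simp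
  have hb := ExtendsFrame.of_iso hg hε hga hrk (Or.inr rfl : (-1 : ℤ) = 1 ∨ (-1 : ℤ) = -1)
  refine ⟨_, g.symm y, g.symm y', hb, ?_, ?_, ?_, ?_, ?_, ?_, ?_, ?_, ?_, ?_, ?_, ?_⟩
  · rw [key', dotProduct_smul, hphi, hr0]; simp
  · rw [← hg.mem_iff]; simpa using hy
  · rw [← hg.mem_iff]; simpa using hy'
  all_goals try intro i
  all_goals simp only [key, key', g.apply_symm_apply, y', y, dotProduct_add, add_dotProduct, sub_dotProduct,
    dotProduct_sub, smul_dotProduct, dotProduct_smul, smul_eq_mul, hphi, haa, hae _ _ hrk, hae _ _ htk,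
    hae _ _ huk, hphia, hee, c1, c2, c3 _ _ hrk, c3 _ _ htk, c3 _ _ huk, hr0, ht0, hu0, hrt, hru, htu,
    hrt.symm, hru.symm, htu.symm, hpp]
  · simp; linear_combination hη0 / 4
  · simp; linear_combination hη0 / 4
  · norm_num
  · norm_num
  · fin_cases i <;> simp
  · fin_cases i <;> simp
  · norm_num
  · norm_num
  · apply g.injective
    simp only [map_add, map_sub, g.apply_symm_apply]
    push_cast
    module


/-! ### Roots of `E₇`, their weights, and connectedness of the root graph. -/

theorem IsCFrame.vec {u v w : V} (hu : u ⬝ᵥ u = 1) (hv : v ⬝ᵥ v = 1) (hw : w ⬝ᵥ w = 1)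
    (huv : u ⬝ᵥ v = 0) (huw : u ⬝ᵥ w = 0) (hvw : v ⬝ᵥ w = 0)
    (h1 : u + v ∈ E8Lattice) (h2 : u - v ∈ E8Lattice) (h3 : u + w ∈ E8Lattice)
    (h4 : u - w ∈ E8Lattice) (h5 : v + w ∈ E8Lattice) (h6 : v - w ∈ E8Lattice) :
    IsCFrame ![u, v, w] where
  orthonormal i j := by
    fin_cases i <;> fin_cases j <;>
      simp [hu, hv, hw, huv, huw, hvw, dotProduct_comm v u, dotProduct_comm w u, dotProduct_comm w v]
  add_mem i j hij := by
    fin_cases i <;> fin_cases j <;> simp at hij ⊢ <;> assumption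
  sub_mem i j hij := by
    fin_cases i <;> fin_cases j <;> simp at hij ⊢ <;> assumption
  two_smul_mem i := by
    fin_cases i
    · convert E8Lattice.add_mem h1 h2 using 1
      simp; module
    · convert E8Lattice.sub_mem h1 h2 using 1
      simp; module
    · convert E8Lattice.sub_mem h3 h4 using 1
      simp; module

/-- Roots of the `E₇` lattice `φ^⊥`. -/
structure IsE7Root (α : V) : Prop where
  mem : α ∈ E8Lattice
  norm : α ⬝ᵥ α = 2
  orth : phi ⬝ᵥ α = 0

/-- `l` is a root with `(φ|l) = (α|l) = 1`. -/
structure IsWeight (α l : V) : Prop where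
  mem : l ∈ E8Lattice
  norm : l ⬝ᵥ l = 2
  level : phi ⬝ᵥ l = 1
  root : α ⬝ᵥ l = 1

/-- A pair of roots `α`, `β` with `(α|β) = 1` that have two common weights. -/
def Linked (α β : V) : Prop :=
  α ⬝ᵥ β = 1 ∧ ∃ l l', IsWeight α l ∧ IsWeight α l' ∧ IsWeight β l ∧ IsWeight β l' ∧ l ⬝ᵥ l' = 1

theorem Linked.symm {α β : V} : Linked α β → Linked β α := fun ⟨h, l, l', h1, h2, h3, h4, h5⟩ =>
  ⟨by rwa [dotProduct_comm], l, l', h3, h4, h1, h2, h5⟩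

/-- The frame determined by a root `α` and two of its weights. -/
theorem IsE7Root.isCFrame {α l l' : V} (hα : IsE7Root α) (hl : IsWeight α l) (hl' : IsWeight α l')
    (hll : l ⬝ᵥ l' = 1) :
    IsCFrame ![(1 / 2 : ℂ) • (phi + α), l - (1 / 2 : ℂ) • (phi + α), l' - (1 / 2 : ℂ) • (phi + α)] := by
  have e1 : α ⬝ᵥ phi = 0 := by rw [dotProduct_comm, hα.orth]
  have e2 : l ⬝ᵥ phi = 1 := by rw [dotProduct_comm, hl.level]
  have e3 : l' ⬝ᵥ phi = 1 := by rw [dotProduct_comm, hl'.level]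
  have e4 : l ⬝ᵥ α = 1 := by rw [dotProduct_comm, hl.root]
  have e5 : l' ⬝ᵥ α = 1 := by rw [dotProduct_comm, hl'.root]
  have hm : phi + α ∈ E8Lattice := E8Lattice.add_mem phi_mem hα.mem
  apply IsCFrame.vec
  all_goals try simp only [dotProduct_add, add_dotProduct, sub_dotProduct, dotProduct_sub,
    smul_dotProduct, dotProduct_smul, smul_eq_mul, e1, e2, e3, e4, e5, hα.orth, hα.norm, hl.norm,
    hl'.norm, hl.level, hl'.level, hl.root, hl'.root, hll, phi_dotProduct_phi]; norm_num
  · convert hl.mem using 1; module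
  · convert E8Lattice.sub_mem hm hl.mem using 1; module
  · convert hl'.mem using 1; module
  · convert E8Lattice.sub_mem hm hl'.mem using 1; module
  · convert E8Lattice.sub_mem (E8Lattice.add_mem hl.mem hl'.mem) hm using 1; module
  · convert E8Lattice.sub_mem hl.mem hl'.mem using 1; module

theorem e_dotProduct_e (i j : Fin 8) : e i ⬝ᵥ e j = if i = j then 1 else 0 := by
  rw [e_dotProduct]; simp [e, Pi.single_apply]

theorem isE7Root_e_sub_e {i j : Fin 8} (h : i ≠ j) : IsE7Root (e i - e j) where
  mem := e_sub_e_mem i j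
  norm := by simp [h]; norm_num
  orth := by rw [dotProduct_sub, dotProduct_e, dotProduct_e]; simp [phi]

/-- The vector with coordinates `1/2` on `S` and `-1/2` off `S`. -/
noncomputable def halfVec (S : Finset (Fin 8)) : V := fun i => if i ∈ S then 1 / 2 else -1 / 2

theorem isE7Root_halfVec {S : Finset (Fin 8)} (hS : S.card = 4) : IsE7Root (halfVec S) := by
  have h0 : phi ⬝ᵥ halfVec S = 0 := by
    have : ∀ i, halfVec S i = (if i ∈ S then 1 else 0) - 1 / 2 := fun i => by
      by_cases h : i ∈ S <;> simp [halfVec, h] <;> norm_num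
    rw [phi_dotProduct_eq_sum]
    simp only [this, Finset.sum_sub_distrib, Finset.sum_ite_mem, Finset.univ_inter]
    simp [hS]; norm_num
  refine ⟨⟨Or.inr fun i => ?_, 0, by simpa using h0⟩, ?_, h0⟩
  · by_cases h : i ∈ S
    · exact ⟨0, by simp [halfVec, h, phi]⟩
    · exact ⟨-1, by simp [halfVec, h, phi]; norm_num⟩
  · have : ∀ i, halfVec S i * halfVec S i = 1 / 4 := fun i => by
      by_cases h : i ∈ S <;> simp [halfVec, h] <;> norm_num
    simp [dotProduct, this]; norm_num

/-- The vectors `e i + e p` with `p ∈ S`, `p ≠ i`, are common weights; two of them share only `e i`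
and pair to 1. -/
theorem linked_halfVec {S : Finset (Fin 8)} (hS : S.card = 4) {i j : Fin 8} (hi : i ∈ S)
    (hj : j ∉ S) : Linked (e i - e j) (halfVec S) := by
  obtain ⟨p, hp, q, hq, hpq⟩ := Finset.one_lt_card.1
    (show 1 < (S.erase i).card by rw [Finset.card_erase_of_mem hi, hS]; norm_num)
  have hij : i ≠ j := fun h => hj (h ▸ hi)
  have hw : ∀ p ∈ S.erase i, IsWeight (e i - e j) (e i + e p) ∧ IsWeight (halfVec S) (e i + e p) := by
    intro p hp
    have hpi := Finset.ne_of_mem_erase hp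
    have hpS := Finset.mem_of_mem_erase hp
    have hpj : p ≠ j := fun h => hj (h ▸ hpS)
    have h2 : (e i + e p) ⬝ᵥ (e i + e p) = 2 := by
      simp [hpi.symm]; norm_num
    have h1 : phi ⬝ᵥ (e i + e p) = 1 := by
      rw [dotProduct_add, dotProduct_e, dotProduct_e]; simp [phi]; norm_num
    refine ⟨⟨e_add_e_mem i p, h2, h1, ?_⟩, ⟨e_add_e_mem i p, h2, h1, ?_⟩⟩
    · simp only [sub_dotProduct, dotProduct_add, e_dotProduct_e]
      simp [hpi.symm, hij.symm, hpj.symm]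
    · rw [dotProduct_add, dotProduct_e, dotProduct_e]; simp [halfVec, hi, hpS]; norm_num
  refine ⟨?_, e i + e p, e i + e q, (hw p hp).1, (hw q hq).1, (hw p hp).2, (hw q hq).2, ?_⟩
  · rw [sub_dotProduct, e_dotProduct, e_dotProduct]; simp [halfVec, hi, hj]; norm_num
  · simp only [add_dotProduct, dotProduct_add, e_dotProduct_e]
    simp [(Finset.ne_of_mem_erase hp), (Finset.ne_of_mem_erase hq).symm, hpq]

/-- The root `halfVec S` is then linked to both `e i - e j` and `e k - e l`. The cases `i = k` and
`j = l` are allowed. -/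
theorem exists_separating {i j k l : Fin 8} (h1 : i ≠ j) (h2 : i ≠ l) (h3 : k ≠ j) (h4 : k ≠ l) :
    ∃ S : Finset (Fin 8), S.card = 4 ∧ i ∈ S ∧ k ∈ S ∧ j ∉ S ∧ l ∉ S := by
  obtain ⟨S, hS1, hS2, hS⟩ := Finset.exists_subsuperset_card_eq (s := {i, k}) (t := {j, l}ᶜ) (n := 4)
    (by
      intro x hx
      simp only [Finset.mem_insert, Finset.mem_singleton, Finset.mem_compl, not_or] at hx ⊢
      rcases hx with rfl | rfl
      · exact ⟨h1, h2⟩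
      · exact ⟨h3, h4⟩)
    (Finset.card_le_two.trans (by norm_num))
    (by
      have : ({j, l} : Finset (Fin 8)).card ≤ 2 := Finset.card_le_two
      rw [Finset.card_compl]; simp; omega)
  refine ⟨S, hS, hS1 (by simp), hS1 (by simp), fun h => ?_, fun h => ?_⟩
  · simpa using hS2 h
  · simpa using hS2 h

theorem IsE7Root.classify {α : V} (hα : IsE7Root α) :
    (∃ i j, i ≠ j ∧ α = e i - e j) ∨ ∃ S : Finset (Fin 8), S.card = 4 ∧ α = halfVec S := by
  have h0 := hα.orth
  rw [phi_dotProduct_eq_sum] at h0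
  rcases hα.mem.1 with h | h
  · left
    choose m hm using h
    have hs : ∑ i, m i = 0 := by
      simp only [hm] at h0
      have : (∑ i, (m i : ℂ)) = 0 := by linear_combination 2 * h0
      exact_mod_cast this
    have hne : ∃ i, m i ≠ 0 := by
      by_contra! hc
      have : α = 0 := by ext i; simp [hm, hc]
      have h2 := hα.norm
      simp [this] at h2
    obtain ⟨i, hi⟩ : ∃ i, 0 < m i := by
      by_contra! hc
      have := (Finset.sum_eq_zero_iff_of_nonpos fun i _ => hc i).1 hs
      exact hne.elim fun i hi => hi (this i (Finset.mem_univ i))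
    obtain ⟨j, hj⟩ : ∃ j, m j < 0 := by
      by_contra! hc
      have := (Finset.sum_eq_zero_iff_of_nonneg fun i _ => hc i).1 hs
      exact hne.elim fun i hi => hi (this i (Finset.mem_univ i))
    have hij : i ≠ j := by rintro rfl; omega
    refine ⟨i, j, hij, ?_⟩
    -- The half-norm of `α - (e i - e j)` is `2 - (m i - m j)`, at most 0 because `m i ≥ 1` and `m j
    -- ≤ -1`.
    obtain ⟨k, hk, hk0⟩ := exists_dotProduct_self
      (E8Lattice.sub_mem hα.mem (isE7Root_e_sub_e hij).mem)
    rw [dotProduct_sub_self, (isE7Root_e_sub_e hij).norm, hα.norm, dotProduct_sub, dotProduct_e,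
      dotProduct_e, hm, hm] at hk
    have : (2 - (m i - m j) : ℤ) = (k : ℤ) := by
      have : (2 - (m i - m j) : ℂ) = k := by linear_combination hk / 2
      exact_mod_cast this
    exact sub_eq_zero.1 (hk0 (by omega))
  · right
    have hpm := dotProduct_self_eq_two_of_half hα.norm h
    let S : Finset (Fin 8) := Finset.univ.filter fun i => α i = 1 / 2
    have hαS : α = halfVec S := by
      ext i
      rcases hpm i with h | h
      · simp [halfVec, S, h]
      · have h' : ¬ (α i = 1 / 2) := by rw [h]; norm_num
        simp only [halfVec, S, Finset.mem_filter, Finset.mem_univ, true_and, if_neg h']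
        exact h
    refine ⟨S, ?_, hαS⟩
    have : ∀ i, halfVec S i = (if i ∈ S then 1 else 0) - 1 / 2 := fun i => by
      by_cases h : i ∈ S <;> simp [halfVec, h] <;> norm_num
    rw [hαS] at h0
    simp only [this, Finset.sum_sub_distrib, Finset.sum_ite_mem, Finset.univ_inter] at h0
    simp at h0
    have : (S.card : ℂ) = 4 := by linear_combination h0
    exact_mod_cast this

/-- The root graph of `E₇` is connected. -/
theorem IsE7Root.induction {Q : V → Prop}
    (step : ∀ α β, IsE7Root α → IsE7Root β → Linked α β → Q α → Q β) (h0 : Q (e 0 - e 1))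
    {α : V} (hα : IsE7Root α) : Q α := by
  -- Two integral roots are joined through a half-integral one whose set `S` contains both positive
  -- positions and neither negative one.
  have hop : ∀ {i j k l : Fin 8}, i ≠ j → i ≠ l → k ≠ j → k ≠ l → Q (e i - e j) → Q (e k - e l) := by
    intro i j k l h1 h2 h3 h4 hQ
    obtain ⟨S, hS, hi, hk, hj, hl⟩ := exists_separating h1 h2 h3 h4
    exact step _ _ (isE7Root_halfVec hS) (isE7Root_e_sub_e h4) (linked_halfVec hS hk hl).symm
      (step _ _ (isE7Root_e_sub_e h1) (isE7Root_halfVec hS) (linked_halfVec hS hi hj) hQ)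
  -- A direct hop from `e 0 - e 1` fails if `i = 1` or `j = 0`; the detour through fresh indices
  -- `k`, `l` always works.
  have hint : ∀ i j : Fin 8, i ≠ j → Q (e i - e j) := fun i j hij => by
    obtain ⟨k, l, hk, hl, hkl⟩ := Finset.one_lt_card_iff.1
      (show 1 < ({0, 1, i, j} : Finset (Fin 8))ᶜ.card by
        have : ({0, 1, i, j} : Finset (Fin 8)).card ≤ 4 := Finset.card_le_four
        rw [Finset.card_compl]; simp; omega)
    simp only [Finset.mem_compl, Finset.mem_insert, Finset.mem_singleton, not_or] at hk hl
    exact hop hkl hk.2.2.2 (Ne.symm hl.2.2.1) hij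
      (hop (by decide) (Ne.symm hl.1) hk.2.1 hkl h0)
  rcases hα.classify with ⟨i, j, hij, rfl⟩ | ⟨S, hS, rfl⟩
  · exact hint i j hij
  · obtain ⟨i, hi⟩ := Finset.card_pos.1 (by omega : 0 < S.card)
    obtain ⟨j, hj⟩ := Finset.card_pos.1 (show 0 < Sᶜ.card by rw [Finset.card_compl, hS]; simp)
    have hij : i ≠ j := by rintro rfl; exact Finset.mem_compl.1 hj hi
    exact step _ _ (isE7Root_e_sub_e hij) (isE7Root_halfVec hS)
      (linked_halfVec hS hi (Finset.mem_compl.1 hj)) (hint i j hij)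

theorem exists_weights : ∃ l l', IsWeight (e 0 - e 1) l ∧ IsWeight (e 0 - e 1) l' ∧ l ⬝ᵥ l' = 1 := by
  obtain ⟨S, hS, hi, -, hj, -⟩ := exists_separating (i := 0) (j := 1) (k := 0) (l := 1)
    (by decide) (by decide) (by decide) (by decide)
  obtain ⟨-, l, l', h1, h2, -, -, h3⟩ := linked_halfVec hS hi hj
  exact ⟨l, l', h1, h2, h3⟩

/-! ### Meromorphic functions on `H_κ`: arithmetic and generic nonvanishing. -/

open Filter

theorem mem_hyp {κ : ℂ} {x : V} : x ∈ Hyp κ ↔ phi ⬝ᵥ x = κ := Iff.rfl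

theorem hyp_add_mem {κ κ' : ℂ} {v : V} (hv : κ + phi ⬝ᵥ v = κ') (x : Hyp κ) : (x : V) + v ∈ Hyp κ' := by
  have := mem_hyp.1 x.2
  rw [mem_hyp, dotProduct_add, this, hv]

/-- The orthogonal projection onto `H_κ`. -/
noncomputable def hypProj (κ : ℂ) (y : V) : Hyp κ :=
  ⟨y - ((phi ⬝ᵥ y - κ) / 2) • phi, by
    rw [mem_hyp, dotProduct_sub, dotProduct_smul, phi_dotProduct_phi, smul_eq_mul]; ring⟩

theorem hypProj_coe {κ : ℂ} (x : Hyp κ) : hypProj κ x = x := by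
  apply Subtype.ext
  simp [hypProj, mem_hyp.1 x.2]

theorem analyticAt_dotProduct (r : V) (p : V) : AnalyticAt ℂ (fun y : V => r ⬝ᵥ y) p := by
  unfold dotProduct
  exact Finset.analyticAt_fun_sum _ fun i _ => analyticAt_const.mul
    ((ContinuousLinearMap.proj (R := ℂ) (φ := fun _ : Fin 8 => ℂ) i).analyticAt p)

theorem analyticAt_hypProj (κ : ℂ) (p : V) : AnalyticAt ℂ (fun y => (hypProj κ y : V)) p := by
  unfold hypProj
  exact analyticAt_id.sub ((((analyticAt_dotProduct phi p).sub analyticAt_const).div_const).smul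
    analyticAt_const)

theorem continuous_hypProj (κ : ℂ) : Continuous (hypProj κ) :=
  Continuous.subtype_mk
    (continuous_iff_continuousAt.2 fun p => (analyticAt_hypProj κ p).continuousAt) _

/-- The identity theorem on the hyperplane. Composition with `hypProj` moves the question to a ball
of the ambient space: vanishing on `H_κ` near some `q` would spread over the ball and hence back to
`p`. -/
theorem eventually_frequently_ne_zero {κ : ℂ} {g : V → ℂ} {p : Hyp κ} (hg : AnalyticAt ℂ g p)
    (hf : ∃ᶠ x : Hyp κ in 𝓝 p, g x ≠ 0) :
    ∀ᶠ q : Hyp κ in 𝓝 p, AnalyticAt ℂ g q ∧ ∃ᶠ x : Hyp κ in 𝓝 q, g x ≠ 0 := by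
  have hG : AnalyticAt ℂ (fun y => g (hypProj κ y)) (p : V) := by
    refine AnalyticAt.fun_comp ?_ (analyticAt_hypProj κ p)
    rwa [hypProj_coe]
  obtain ⟨r, hr, hball⟩ := Metric.eventually_nhds_iff_ball.1 hG.eventually_analyticAt
  have hin : ∀ᶠ q : Hyp κ in 𝓝 p, (q : V) ∈ Metric.ball (p : V) r :=
    continuous_subtype_val.continuousAt.eventually (Metric.ball_mem_nhds _ hr)
  have han : ∀ᶠ q : Hyp κ in 𝓝 p, AnalyticAt ℂ g q :=
    continuous_subtype_val.continuousAt.eventually hg.eventually_analyticAt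
  filter_upwards [hin, han] with q hq hqa
  refine ⟨hqa, fun hc => hf ?_⟩
  have hz : (fun y => g (hypProj κ y)) =ᶠ[𝓝 (q : V)] 0 := by
    have := (continuous_hypProj κ).continuousAt (x := (q : V))
    rw [ContinuousAt, hypProj_coe] at this
    filter_upwards [this.eventually hc] with y hy
    simpa using hy
  have hEq := AnalyticOnNhd.eqOn_zero_of_preconnected_of_eventuallyEq_zero (fun y hy => hball y hy)
    (convex_ball (p : V) r).isPreconnected hq hz
  filter_upwards [hin] with x hx
  have := hEq hx
  simpa [hypProj_coe] using this

theorem eventually_nhds_ne_zero {κ : ℂ} {g : V → ℂ} {p : Hyp κ} (hg : AnalyticAt ℂ g p)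
    (h : g p ≠ 0) : ∀ᶠ x : Hyp κ in 𝓝 p, g x ≠ 0 :=
  continuous_subtype_val.continuousAt.eventually (hg.continuousAt.eventually_ne h)

/-- Germs of holomorphic functions have no zero divisors: arbitrarily near `p` there is a `q` with
`g q ≠ 0`, and `h` is not identically zero near `q`. -/
theorem frequently_mul_ne_zero {κ : ℂ} {g h : V → ℂ} {p : Hyp κ} (hg : AnalyticAt ℂ g p)
    (hh : AnalyticAt ℂ h p) (hg0 : ∃ᶠ x : Hyp κ in 𝓝 p, g x ≠ 0)
    (hh0 : ∃ᶠ x : Hyp κ in 𝓝 p, h x ≠ 0) : ∃ᶠ x : Hyp κ in 𝓝 p, g x * h x ≠ 0 := by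
  intro hc
  obtain ⟨q, hq, ⟨-, hqh⟩, hqg, hqc⟩ := (hg0.and_eventually
    ((eventually_frequently_ne_zero hh hh0).and
      ((eventually_frequently_ne_zero hg hg0).and (eventually_eventually_nhds.2 hc)))).exists
  obtain ⟨x, hx, hxg, hxc⟩ :=
    (hqh.and_eventually ((eventually_nhds_ne_zero hqg.1 hq).and hqc)).exists
  exact hxc (mul_ne_zero hxg hx)

namespace IsMeromorphicAt

variable {κ : ℂ} {f f' : Hyp κ → ℂ} {p : Hyp κ}

theorem mul (hf : IsMeromorphicAt f p) (hf' : IsMeromorphicAt f' p) :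
    IsMeromorphicAt (fun x => f x * f' x) p := by
  obtain ⟨g, h, hg, hh, h0, he⟩ := hf
  obtain ⟨g', h', hg', hh', h0', he'⟩ := hf'
  refine ⟨fun x => g x * g' x, fun x => h x * h' x, hg.mul hg', hh.mul hh',
    frequently_mul_ne_zero hh hh' h0 h0', ?_⟩
  filter_upwards [he, he'] with x hx hx' hne
  rw [hx (left_ne_zero_of_mul hne), hx' (right_ne_zero_of_mul hne), div_mul_div_comm]

theorem sub (hf : IsMeromorphicAt f p) (hf' : IsMeromorphicAt f' p) :
    IsMeromorphicAt (fun x => f x - f' x) p := by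
  obtain ⟨g, h, hg, hh, h0, he⟩ := hf
  obtain ⟨g', h', hg', hh', h0', he'⟩ := hf'
  refine ⟨fun x => g x * h' x - h x * g' x, fun x => h x * h' x, (hg.mul hh').sub (hh.mul hg'),
    hh.mul hh', frequently_mul_ne_zero hh hh' h0 h0', ?_⟩
  filter_upwards [he, he'] with x hx hx' hne
  rw [hx (left_ne_zero_of_mul hne), hx' (right_ne_zero_of_mul hne),
    div_sub_div _ _ (left_ne_zero_of_mul hne) (right_ne_zero_of_mul hne)]

theorem of_analyticAt {g : V → ℂ} (hg : AnalyticAt ℂ g p) : IsMeromorphicAt (fun x : Hyp κ => g x) p :=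
  ⟨g, fun _ => 1, hg, analyticAt_const, (Eventually.of_forall fun _ => one_ne_zero).frequently,
    Eventually.of_forall fun _ _ => by simp⟩

theorem inv (hf : IsMeromorphicAt f p) (hne : ∀ᶠ x in generic (Hyp κ), f x ≠ 0) :
    IsMeromorphicAt (fun x => (f x)⁻¹) p := by
  obtain ⟨g, h, hg, hh, h0, he⟩ := hf
  have hg0 : ∃ᶠ x : Hyp κ in 𝓝 p, g x ≠ 0 := by
    intro hc
    obtain ⟨q, hq, ⟨hqa, -⟩, hqc⟩ := (h0.and_eventually ((eventually_frequently_ne_zero hh h0).and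
      (eventually_eventually_nhds.2 (he.and hc)))).exists
    have hd : Dense (interior {x | f x ≠ 0}) := hne
    obtain ⟨x, hx, hxh, hxc⟩ := ((mem_closure_iff_frequently.1 (hd q)).and_eventually
      ((eventually_nhds_ne_zero hqa hq).and hqc)).exists
    have := interior_subset hx
    apply this
    rw [hxc.1 hxh, not_not.1 hxc.2, zero_div]
  -- The inverse `h/g` is expanded by `h`, since `f = g/h` is known only where `h` is nonzero.
  refine ⟨fun x => h x * h x, fun x => g x * h x, hh.mul hh, hg.mul hh,
    frequently_mul_ne_zero hg hh hg0 h0, ?_⟩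
  filter_upwards [he] with x hx hne
  have h1 := left_ne_zero_of_mul hne
  have h2 := right_ne_zero_of_mul hne
  rw [hx h2]
  field_simp

theorem comp_add {κ' : ℂ} {f : Hyp κ' → ℂ} (hf : ∀ q, IsMeromorphicAt f q) {v : V}
    (hv : κ + phi ⬝ᵥ v = κ') (p : Hyp κ) :
    IsMeromorphicAt (fun x : Hyp κ => f ⟨x + v, hyp_add_mem hv x⟩) p := by
  obtain ⟨g, h, hg, hh, h0, he⟩ := hf ⟨p + v, hyp_add_mem hv p⟩
  have hv' : κ' + phi ⬝ᵥ (-v) = κ := by rw [dotProduct_neg, ← hv]; ring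
  have ht : AnalyticAt ℂ (fun y : V => y + v) p := analyticAt_id.add analyticAt_const
  have hc : Continuous fun x : Hyp κ => (⟨x + v, hyp_add_mem hv x⟩ : Hyp κ') := by fun_prop
  have hc' : Continuous fun x : Hyp κ' => (⟨x + -v, hyp_add_mem hv' x⟩ : Hyp κ) := by fun_prop
  refine ⟨fun y => g (y + v), fun y => h (y + v), AnalyticAt.fun_comp (g := g) hg ht,
    AnalyticAt.fun_comp (g := h) hh ht, ?_,
    hc.continuousAt.eventually he⟩
  intro hz
  apply h0
  have := hc'.continuousAt (x := ⟨p + v, hyp_add_mem hv p⟩)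
  have hp : (⟨((⟨p + v, hyp_add_mem hv p⟩ : Hyp κ') : V) + -v, hyp_add_mem hv' _⟩ : Hyp κ) = p :=
    Subtype.ext (by simp)
  rw [ContinuousAt, hp] at this
  filter_upwards [this.eventually hz] with x hx
  simpa using hx

/-- A meromorphic function vanishes generically near a point or is generically nonzero there. -/
theorem dichotomy (hf : IsMeromorphicAt f p) :
    p ∈ interior (closure (interior {x | f x = 0})) ∨
      p ∈ interior (closure (interior {x | f x ≠ 0})) := by
  obtain ⟨g, h, hg, hh, h0, he⟩ := hf
  by_cases hg0 : ∃ᶠ x : Hyp κ in 𝓝 p, g x ≠ 0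
  · right
    rw [mem_interior_iff_mem_nhds]
    filter_upwards [eventually_frequently_ne_zero (hg.mul hh) (frequently_mul_ne_zero hg hh hg0 h0),
      eventually_eventually_nhds.2 (eventually_eventually_nhds.2 he)] with q hq hqe
    rw [mem_closure_iff_frequently]
    refine (hq.2.and_eventually (hqe.and (eventually_frequently_ne_zero hq.1 hq.2))).mono ?_
    rintro x ⟨hx, hxe, hxa, -⟩
    rw [mem_interior_iff_mem_nhds]
    filter_upwards [hxe, eventually_nhds_ne_zero hxa hx] with y hy hy0
    have hy0' : g y * h y ≠ 0 := hy0
    rw [hy (right_ne_zero_of_mul hy0')]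
    exact div_ne_zero (left_ne_zero_of_mul hy0') (right_ne_zero_of_mul hy0')
  · left
    rw [mem_interior_iff_mem_nhds]
    filter_upwards [eventually_frequently_ne_zero hh h0,
      eventually_eventually_nhds.2 (eventually_eventually_nhds.2 (he.and (not_frequently.1 hg0)))]
      with q hq hqe
    rw [mem_closure_iff_frequently]
    refine (hq.2.and_eventually (hqe.and (eventually_frequently_ne_zero hq.1 hq.2))).mono ?_
    rintro x ⟨hx, hxe, hxa, -⟩
    rw [mem_interior_iff_mem_nhds]
    filter_upwards [hxe, eventually_nhds_ne_zero hxa hx] with y hy hy0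
    rw [hy.1 hy0, not_not.1 hy.2, zero_div]

end IsMeromorphicAt

instance (κ : ℂ) : PreconnectedSpace (Hyp κ) := by
  have : Convex ℝ (Hyp κ) := by
    intro x hx y hy a b _ _ hab
    rw [mem_hyp] at *
    rw [dotProduct_add, dotProduct_smul, dotProduct_smul, hx, hy, ← add_smul, hab, one_smul]
  exact isPreconnected_iff_preconnectedSpace.1 this.isPreconnected

namespace MeroFun

theorem eval_coe {κ : ℂ} (τ : MeroFun κ) (x : Hyp κ) : τ x = τ.rep x := by
  simp [eval, x.2]

theorem eval_add {κ κ' : ℂ} (τ : MeroFun κ') {v : V} (hv : κ + phi ⬝ᵥ v = κ') (x : Hyp κ) :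
    τ (x + v) = τ.rep ⟨x + v, hyp_add_mem hv x⟩ :=
  τ.eval_coe ⟨x + v, hyp_add_mem hv x⟩

theorem isMeromorphicAt_add {κ κ' : ℂ} (τ : MeroFun κ') {v : V} (hv : κ + phi ⬝ᵥ v = κ') (p : Hyp κ) :
    IsMeromorphicAt (fun x : Hyp κ => τ (x + v)) p := by
  simp only [τ.eval_add hv]
  exact IsMeromorphicAt.comp_add τ.rep_spec.1 hv p

theorem ext_of_eventually {κ : ℂ} {τ τ' : MeroFun κ} (h : ∀ᶠ x : Hyp κ in generic (Hyp κ), τ x = τ' x) :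
    τ = τ' := by
  apply Subtype.ext
  rw [← τ.rep_spec.2, ← τ'.rep_spec.2, Germ.coe_eq]
  simp only [eval_coe] at h
  exact h

/-- A meromorphic function that is not identically zero is generically nonzero. -/
theorem eventually_ne_zero {κ : ℂ} {τ : MeroFun κ} (h : ¬ τ.IsZero) :
    ∀ᶠ x : Hyp κ in generic (Hyp κ), τ x ≠ 0 := by
  simp only [eval_coe]
  set A := interior {x | τ.rep x = 0}
  set B := interior {x | τ.rep x ≠ 0}
  have hAB : Disjoint A B := by
    rw [Set.disjoint_left]
    intro x hx hx'
    exact (show τ.rep x ≠ 0 from interior_subset hx') (show τ.rep x = 0 from interior_subset (s := {x | τ.rep x = 0}) hx)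
  have hd : Disjoint (interior (closure A)) (interior (closure B)) := by
    have h1 : Disjoint A (closure B) := hAB.closure_right isOpen_interior
    have h2 : Disjoint (closure A) (interior (closure B)) :=
      (h1.mono_right interior_subset).closure_left isOpen_interior
    exact h2.mono_left interior_subset
  have hU : Set.univ ⊆ interior (closure A) ∪ interior (closure B) := fun p _ =>
    (τ.rep_spec.1 p).dichotomy
  -- The local dichotomy covers the connected space `H_κ` by two disjoint open sets, so one of them
  -- is everything.
  have hor : Set.univ ⊆ interior (closure A) ∨ Set.univ ⊆ interior (closure B) := by
    apply isPreconnected_univ.subset_or_subset isOpen_interior isOpen_interior hd hU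
  rcases hor with hA | hB
  · refine absurd ?_ h
    rw [IsZero, ← τ.rep_spec.2]
    refine Germ.coe_eq.2 ?_
    change Dense A
    exact fun x => interior_subset (hA (Set.mem_univ x))
  · change Dense B
    exact fun x => interior_subset (hB (Set.mem_univ x))

end MeroFun

/-! ### The bracket: oddness and generic nonvanishing. -/

namespace IsBracket

variable {s : ℂ → ℂ}

theorem map_zero (hs : IsBracket s) : s 0 = 0 := by
  have := hs.three_term 0 0 0 0
  simp at this
  have h4 : 3 * s 0 ^ 4 = 0 := by linear_combination this
  simpa using h4

theorem analyticAt (hs : IsBracket s) (z : ℂ) : AnalyticAt ℂ s z := hs.entire.analyticAt z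

theorem dense_ne_zero (hs : IsBracket s) : Dense {z | s z ≠ 0} := by
  intro z
  rw [mem_closure_iff_frequently]
  intro hc
  apply hs.ne_zero
  have : s =ᶠ[𝓝 z] 0 := by filter_upwards [hc] with y hy; simpa using hy
  exact AnalyticOnNhd.eq_of_eventuallyEq (fun y _ => hs.analyticAt y) (fun y _ => analyticAt_const) this

/-- With `z = α` one term of the three-term relation contains `[0] = 0`. The two others combine to
`[p][q][p+q+u]([u] + [-u])`, and density of the nonzero set provides `p`, `q` that can be cancelled.
-/
theorem neg (hs : IsBracket s) (u : ℂ) : s (-u) = -s u := by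
  have hopen : IsOpen {z | s z ≠ 0} := isOpen_ne_fun hs.entire.continuous continuous_const
  obtain ⟨p, hp⟩ := hs.dense_ne_zero.nonempty
  have h2 : Dense {q | s (p + q + u) ≠ 0} := by
    have := hs.dense_ne_zero.preimage (f := fun q => p + q + u)
      ((Homeomorph.addLeft p).trans (Homeomorph.addRight u)).isOpenMap
    exact this
  obtain ⟨q, hq, hq'⟩ := (h2.inter_of_isOpen_right hs.dense_ne_zero hopen).nonempty
  have h := hs.three_term ((p + q) / 2) ((p + q) / 2) ((p - q) / 2) ((p + q) / 2 + u)
  have e1 : (p + q) / 2 + (p - q) / 2 = p := by ring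
  have e2 : (p + q) / 2 - (p - q) / 2 = q := by ring
  have e3 : (p + q) / 2 + ((p + q) / 2 + u) = p + q + u := by ring
  have e4 : (p + q) / 2 - ((p + q) / 2 + u) = -u := by ring
  have e5 : (p + q) / 2 + u + (p + q) / 2 = p + q + u := by ring
  have e6 : (p + q) / 2 + u - (p + q) / 2 = u := by ring
  rw [e1, e2, e3, e4, e5, e6, sub_self, hs.map_zero] at h
  have h' : s p * s q * s (p + q + u) * (s u + s (-u)) = 0 := by linear_combination h
  have hne : s p * s q * s (p + q + u) ≠ 0 := mul_ne_zero (mul_ne_zero hp hq') hq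
  have := (mul_eq_zero.1 h').resolve_left hne
  linear_combination this

/-- `[(r|x) + d]` does not vanish identically on `H_κ`. -/
theorem eventually_ne_zero (hs : IsBracket s) {κ : ℂ} {r : V} (hr : phi ⬝ᵥ r = 0)
    (hrr : r ⬝ᵥ r ≠ 0) (d : ℂ) : ∀ᶠ x : Hyp κ in generic (Hyp κ), s (r ⬝ᵥ x + d) ≠ 0 := by
  have hc : Continuous fun x : Hyp κ => s (r ⬝ᵥ (x : V) + d) :=
    hs.entire.continuous.comp ((continuous_const.dotProduct continuous_subtype_val).add
      continuous_const)
  have ho : IsOpen {x : Hyp κ | s (r ⬝ᵥ (x : V) + d) ≠ 0} := isOpen_ne_fun hc continuous_const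
  change Dense (interior {x : Hyp κ | s (r ⬝ᵥ (x : V) + d) ≠ 0})
  rw [ho.interior_eq]
  intro p
  have hmem : ∀ t : ℂ, (p : V) + t • r ∈ Hyp κ := fun t => by
    rw [mem_hyp, dotProduct_add, dotProduct_smul, hr, mem_hyp.1 p.2]; simp
  -- The line through `p` in direction `r` stays in `H_κ`, and along it the argument of `s` is
  -- affine with slope `(r|r) ≠ 0`.
  let γ : ℂ → Hyp κ := fun t => ⟨p + t • r, hmem t⟩
  have hγ : Continuous γ := by fun_prop
  have hγ0 : γ 0 = p := Subtype.ext (by simp [γ])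
  have hd : Dense {t : ℂ | s (t * (r ⬝ᵥ r) + (r ⬝ᵥ p + d)) ≠ 0} :=
    hs.dense_ne_zero.preimage (f := fun t => t * (r ⬝ᵥ r) + (r ⬝ᵥ p + d))
      ((Homeomorph.mulRight₀ _ hrr).trans (Homeomorph.addRight (r ⬝ᵥ p + d))).isOpenMap
  rw [← hγ0]
  refine closure_mono ?_ (image_closure_subset_closure_image hγ (Set.mem_image_of_mem γ (hd 0)))
  rintro _ ⟨t, ht, rfl⟩
  have : r ⬝ᵥ ((p : V) + t • r) + d = t * (r ⬝ᵥ r) + (r ⬝ᵥ p + d) := by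
    rw [dotProduct_add, dotProduct_smul, smul_eq_mul]; ring
  change s (r ⬝ᵥ ((p : V) + t • r) + d) ≠ 0
  rw [this]; exact ht

end IsBracket

theorem pm_eq (s : ℂ → ℂ) (u v x : V) :
    pm s u v x = s (u ⬝ᵥ x + v ⬝ᵥ x) * s (u ⬝ᵥ x - v ⬝ᵥ x) := by
  rw [pm, add_dotProduct, sub_dotProduct]

theorem IsBracket.pm_three_term {s : ℂ → ℂ} (hs : IsBracket s) (a u v w x : V) :
    pm s v w x * pm s a u x + pm s w u x * pm s a v x + pm s u v x * pm s a w x = 0 := by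
  simp only [pm_eq]
  exact hs.three_term _ _ _ _

theorem IsBracket.pm_swap {s : ℂ → ℂ} (hs : IsBracket s) (u v x : V) : pm s v u x = -pm s u v x := by
  simp only [pm_eq]
  rw [add_comm, show v ⬝ᵥ x - u ⬝ᵥ x = -(u ⬝ᵥ x - v ⬝ᵥ x) by ring, hs.neg]; ring

theorem pm_neg_right (s : ℂ → ℂ) (u v x : V) : pm s u (-v) x = pm s u v x := by
  simp only [pm_eq, neg_dotProduct]; rw [← sub_eq_add_neg, sub_neg_eq_add]; ring

theorem IsBracket.eventually_pm_ne_zero {s : ℂ → ℂ} (hs : IsBracket s) {κ : ℂ} {u v : V}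
    (hu : u ⬝ᵥ u = 1) (hv : v ⬝ᵥ v = 1) (huv : u ⬝ᵥ v = 0) (hu0 : phi ⬝ᵥ u = 0)
    (hv0 : phi ⬝ᵥ v = 0) : ∀ᶠ x : Hyp κ in generic (Hyp κ), pm s u v x ≠ 0 := by
  filter_upwards [hs.eventually_ne_zero (κ := κ) (r := u + v) (by rw [dotProduct_add, hu0, hv0, add_zero])
      (by rw [dotProduct_add_self, hu, hv, huv]; norm_num) 0,
    hs.eventually_ne_zero (κ := κ) (r := u - v) (by rw [dotProduct_sub, hu0, hv0, sub_zero])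
      (by rw [dotProduct_sub_self, hu, hv, huv]; norm_num) 0] with x h1 h2
  rw [add_zero] at h1 h2
  exact mul_ne_zero h1 h2

/-! ### Equations of type (II₁): solving one of them and propagating it to all frames. -/

/-- The equation of type (II₁) for the frame `{±a₀, ±u, ±v}` at a point. -/
def EqII1At (s : ℂ → ℂ) (δ : ℂ) {κm κ κp : ℂ} (τm : MeroFun κm) (τ : MeroFun κ) (τp : MeroFun κp)
    (a₀ u v x : V) : Prop :=
  pm s u v x * (τm (x - δ • a₀) * τp (x + δ • a₀)) =
    pm s a₀ v x * (τ (x + δ • u) * τ (x - δ • u)) -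
    pm s a₀ u x * (τ (x + δ • v) * τ (x - δ • v))

/-- The equation of type (II₁) for the frame `{±a₀, ±u, ±v}`. -/
def EqII1 (s : ℂ → ℂ) (δ : ℂ) {κm κ κp : ℂ} (τm : MeroFun κm) (τ : MeroFun κ) (τp : MeroFun κp)
    (a₀ u v : V) : Prop :=
  ∀ᶠ x : Hyp κ in generic (Hyp κ), EqII1At s δ τm τ τp a₀ u v x

/-- The equation of type (II₁) for the root `α` and its weights `l`, `l'`, written at the argument
of `τp`. -/
def WeightEqAt (s : ℂ → ℂ) (δ : ℂ) {κm κ κp : ℂ} (τm : MeroFun κm) (τ : MeroFun κ) (τp : MeroFun κp)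
    (α l l' x : V) : Prop :=
  s ((l - l') ⬝ᵥ x) * s ((l + l' - phi - α) ⬝ᵥ x) * (τm (x - δ • (phi + α)) * τp x) =
    s (l' ⬝ᵥ x - δ) * s ((phi + α - l') ⬝ᵥ x - δ) * (τ (x - δ • l) * τ (x - δ • (phi + α - l))) -
    s (l ⬝ᵥ x - δ) * s ((phi + α - l) ⬝ᵥ x - δ) * (τ (x - δ • l') * τ (x - δ • (phi + α - l')))

/-- The equation `WeightEqAt` as an identity of meromorphic functions. -/
def WeightEq (s : ℂ → ℂ) (δ : ℂ) {κm κ κp : ℂ} (τm : MeroFun κm) (τ : MeroFun κ) (τp : MeroFun κp)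
    (α l l' : V) : Prop :=
  ∀ᶠ x : Hyp κp in generic (Hyp κp), WeightEqAt s δ τm τ τp α l l' x

section

variable {s : ℂ → ℂ} {δ κ₀ κ₁ κ₂ : ℂ} {τ₀ : MeroFun κ₀} {τ₁ : MeroFun κ₁} {τ₂ : MeroFun κ₂}

/-- Translation by `δ(φ+α)/2` places `τ₂` at `x` itself for every root, so equations of different
roots become comparable. -/
theorem eqII1_iff_weightEq (h12 : κ₁ + δ = κ₂) {α l l' : V} (hα : IsE7Root α) (hl : IsWeight α l)
    (hl' : IsWeight α l') :
    EqII1 s δ τ₀ τ₁ τ₂ ((1 / 2 : ℂ) • (phi + α)) (l - (1 / 2 : ℂ) • (phi + α))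
      (l' - (1 / 2 : ℂ) • (phi + α)) ↔ WeightEq s δ τ₀ τ₁ τ₂ α l l' := by
  have e1 : α ⬝ᵥ phi = 0 := by rw [dotProduct_comm, hα.orth]
  have e2 : l ⬝ᵥ phi = 1 := by rw [dotProduct_comm, hl.level]
  have e3 : l' ⬝ᵥ phi = 1 := by rw [dotProduct_comm, hl'.level]
  have e4 : l ⬝ᵥ α = 1 := by rw [dotProduct_comm, hl.root]
  have e5 : l' ⬝ᵥ α = 1 := by rw [dotProduct_comm, hl'.root]
  -- both equations agree at corresponding points
  have key : ∀ x y : V, x = y + δ • (1 / 2 : ℂ) • (phi + α) →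
      (EqII1At s δ τ₀ τ₁ τ₂ ((1 / 2 : ℂ) • (phi + α)) (l - (1 / 2 : ℂ) • (phi + α))
        (l' - (1 / 2 : ℂ) • (phi + α)) y ↔ WeightEqAt s δ τ₀ τ₁ τ₂ α l l' x) := by
    intro x y hxy
    have p1 : x - δ • (phi + α) = y - δ • (1 / 2 : ℂ) • (phi + α) := by rw [hxy]; module
    have p2 : ∀ l : V, x - δ • l = y - δ • (l - (1 / 2 : ℂ) • (phi + α)) := fun l => by
      rw [hxy]; module
    have p3 : ∀ l : V, y - δ • (phi + α - l - (1 / 2 : ℂ) • (phi + α)) =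
      y + δ • (l - (1 / 2 : ℂ) • (phi + α)) := fun l => by module
    have q1 : (l - l') ⬝ᵥ x =
        (l - (1 / 2 : ℂ) • (phi + α)) ⬝ᵥ y - (l' - (1 / 2 : ℂ) • (phi + α)) ⬝ᵥ y := by
      rw [hxy]
      simp only [add_dotProduct, sub_dotProduct, smul_dotProduct, dotProduct_add, dotProduct_smul,
        smul_eq_mul, e2, e3, e4, e5]; ring
    have q2 : (l + l' - phi - α) ⬝ᵥ x =
        (l - (1 / 2 : ℂ) • (phi + α)) ⬝ᵥ y + (l' - (1 / 2 : ℂ) • (phi + α)) ⬝ᵥ y := by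
      rw [hxy]
      simp only [add_dotProduct, sub_dotProduct, smul_dotProduct, dotProduct_add, dotProduct_smul,
        smul_eq_mul, e1, e2, e3, e4, e5, hα.orth, hα.norm, phi_dotProduct_phi]; ring
    have q3 : ∀ l, l ⬝ᵥ phi = 1 → l ⬝ᵥ α = 1 → l ⬝ᵥ x - δ =
        ((1 / 2 : ℂ) • (phi + α)) ⬝ᵥ y + (l - (1 / 2 : ℂ) • (phi + α)) ⬝ᵥ y := fun l e e' => by
      rw [hxy]
      simp only [add_dotProduct, sub_dotProduct, smul_dotProduct, dotProduct_add, dotProduct_smul,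
        smul_eq_mul, e, e']; ring
    have q4 : ∀ l, l ⬝ᵥ phi = 1 → l ⬝ᵥ α = 1 → (phi + α - l) ⬝ᵥ x - δ =
        ((1 / 2 : ℂ) • (phi + α)) ⬝ᵥ y - (l - (1 / 2 : ℂ) • (phi + α)) ⬝ᵥ y := fun l e e' => by
      rw [hxy]
      simp only [add_dotProduct, sub_dotProduct, smul_dotProduct, dotProduct_add, dotProduct_smul,
        smul_eq_mul, e, e', e1, hα.orth, hα.norm, phi_dotProduct_phi]; ring
    unfold EqII1At WeightEqAt
    rw [p1, p2 l, p2 l', p2 (phi + α - l), p2 (phi + α - l'), p3, p3, q1, q2, q3 l e2 e4, q3 l' e3 e5,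
      q4 l e2 e4, q4 l' e3 e5, ← hxy]
    simp only [pm_eq]
    constructor <;> intro h <;> linear_combination h
  have hphi : phi ⬝ᵥ (δ • (1 / 2 : ℂ) • (phi + α)) = δ := by
    simp only [dotProduct_smul, dotProduct_add, hα.orth, phi_dotProduct_phi, smul_eq_mul]; ring
  constructor
  · intro h
    have := eventually_shift (κ := κ₂) (-(δ • (1 / 2 : ℂ) • (phi + α)))
      (by rw [dotProduct_neg, hphi, ← h12]; ring)
      (EqII1At s δ τ₀ τ₁ τ₂ ((1 / 2 : ℂ) • (phi + α)) (l - (1 / 2 : ℂ) • (phi + α))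
        (l' - (1 / 2 : ℂ) • (phi + α))) h
    filter_upwards [this] with x hx
    exact (key x _ (neg_add_cancel_right _ _).symm).1 hx
  · intro h
    have := eventually_shift (κ := κ₁) (δ • (1 / 2 : ℂ) • (phi + α)) (by rw [hphi, ← h12])
      (WeightEqAt s δ τ₀ τ₁ τ₂ α l l') h
    filter_upwards [this] with y hy
    exact (key _ y rfl).2 hy

/-- `u` belongs to the part orthogonal to `φ` of the frame of `a₀`. -/
structure IsMate (a₀ u : V) : Prop where
  norm : u ⬝ᵥ u = 1
  orth : phi ⬝ᵥ u = 0
  add_mem : a₀ + u ∈ E8Lattice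
  sub_mem : a₀ - u ∈ E8Lattice

theorem IsMate.add_mem' {a₀ u v : V} (hu : IsMate a₀ u) (hv : IsMate a₀ v) : u + v ∈ E8Lattice := by
  convert E8Lattice.sub_mem hu.add_mem hv.sub_mem using 1; module

theorem IsMate.sub_mem' {a₀ u v : V} (hu : IsMate a₀ u) (hv : IsMate a₀ v) : u - v ∈ E8Lattice := by
  convert E8Lattice.sub_mem hu.add_mem hv.add_mem using 1; module

theorem EqII1.swap (hs : IsBracket s) {a₀ u v : V} (h : EqII1 s δ τ₀ τ₁ τ₂ a₀ u v) :
    EqII1 s δ τ₀ τ₁ τ₂ a₀ v u := by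
  filter_upwards [h] with x hx
  unfold EqII1At at *
  rw [hs.pm_swap u v]
  linear_combination -hx

theorem EqII1.neg_right {a₀ u v : V} (h : EqII1 s δ τ₀ τ₁ τ₂ a₀ u v) :
    EqII1 s δ τ₀ τ₁ τ₂ a₀ u (-v) := by
  filter_upwards [h] with x hx
  unfold EqII1At at *
  rw [pm_neg_right, pm_neg_right, smul_neg, sub_neg_eq_add, ← sub_eq_add_neg]
  linear_combination hx

theorem EqII1.self (hs : IsBracket s) (a₀ u : V) : EqII1 s δ τ₀ τ₁ τ₂ a₀ u u := by
  refine Eventually.of_forall fun x => ?_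
  unfold EqII1At
  rw [pm_eq s u u, sub_self, hs.map_zero]; ring

/-- Exchange of a member of the frame, by the three-term relation and (II₀). -/
theorem EqII1.exchange (hs : IsBracket s) (h0 : HirotaII0 s δ τ₁) {a₀ u v w : V} (hu : IsMate a₀ u)
    (hv : IsMate a₀ v) (hw : IsMate a₀ w) (huv : u ⬝ᵥ v = 0) (h : EqII1 s δ τ₀ τ₁ τ₂ a₀ u v) :
    EqII1 s δ τ₀ τ₁ τ₂ a₀ u w := by
  rcases eq_or_eq_neg_or_orthogonal hv.norm hw.norm (hv.add_mem' hw) (hv.sub_mem' hw) with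
    rfl | rfl | hvw
  · exact h
  · exact h.neg_right
  rcases eq_or_eq_neg_or_orthogonal hu.norm hw.norm (hu.add_mem' hw) (hu.sub_mem' hw) with
    rfl | rfl | huw
  · exact EqII1.self hs _ _
  · exact (EqII1.self hs _ _).neg_right
  have hF := h0 _ (IsCFrame.vec hu.norm hv.norm hw.norm huv huw hvw (hu.add_mem' hv) (hu.sub_mem' hv)
    (hu.add_mem' hw) (hu.sub_mem' hw) (hv.add_mem' hw) (hv.sub_mem' hw))
    (fun i => by fin_cases i; exacts [hu.orth, hv.orth, hw.orth])
  filter_upwards [h, hF, hs.eventually_pm_ne_zero hu.norm hv.norm huv hu.orth hv.orth] with x hx hx0 hne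
  simp only [Matrix.cons_val] at hx0
  unfold EqII1At at *
  apply mul_left_cancel₀ hne
  rw [hs.pm_swap u w] at hx0
  have h3 := hs.pm_three_term a₀ u v w x
  rw [hs.pm_swap u w] at h3
  -- (II₀) for `u`, `v`, `w` eliminates the `v` term in favour of `w`; the three-term relation at
  -- `a₀` then collects the coefficient of the `u` term.
  linear_combination pm s u w x * hx + pm s a₀ u x * hx0 - (τ₁ (x + δ • u) * τ₁ (x - δ • u)) * h3

/-- Members are exchanged one at a time; when `b` is orthogonal to `u` the passage is `(u,v) → (u,b)
→ (b,c)`. -/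
theorem EqII1.of_mates (hs : IsBracket s) (h0 : HirotaII0 s δ τ₁) {a₀ u v b c : V} (hu : IsMate a₀ u)
    (hv : IsMate a₀ v) (huv : u ⬝ᵥ v = 0) (hb : IsMate a₀ b) (hc : IsMate a₀ c)
    (h : EqII1 s δ τ₀ τ₁ τ₂ a₀ u v) : EqII1 s δ τ₀ τ₁ τ₂ a₀ b c := by
  rcases eq_or_eq_neg_or_orthogonal hu.norm hb.norm (hu.add_mem' hb) (hu.sub_mem' hb) with
    rfl | rfl | hub
  · exact h.exchange hs h0 hu hv hc huv
  · exact ((h.exchange hs h0 hu hv hc huv).swap hs |>.neg_right).swap hs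
  · exact ((h.exchange hs h0 hu hv hb huv).swap hs).exchange hs h0 hb hu hc (by rwa [dotProduct_comm])

/-- The equation of type (I) for the frame with `2c₀ = β - α + l`, `2c₁ = α - β + l`. -/
theorem HirotaI.weightEq {κ : ℂ} (hκ : κ + 3 / 2 * δ = κ₂) (hI : HirotaI s δ κ τ₀ τ₁) {α β l l' : V}
    (hα : IsE7Root α) (hβ : IsE7Root β) (hαβ : α ⬝ᵥ β = 1) (hl : IsWeight α l) (hl' : IsWeight α l')
    (hlb : IsWeight β l) (hlb' : IsWeight β l') (hll : l ⬝ᵥ l' = 1) :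
    ∀ᶠ x : Hyp κ₂ in generic (Hyp κ₂),
      s ((phi + α - l') ⬝ᵥ x - δ) * s ((l + l' - phi - β) ⬝ᵥ x) *
        (τ₀ (x - δ • (phi + β)) * τ₁ (x - δ • (phi + α - l))) +
      s ((phi + β - l') ⬝ᵥ x - δ) * s ((phi + α - l - l') ⬝ᵥ x) *
        (τ₀ (x - δ • (phi + α)) * τ₁ (x - δ • (phi + β - l))) +
      s (l ⬝ᵥ x - δ) * s ((β - α) ⬝ᵥ x) *
        (τ₀ (x - δ • (phi + phi + α + β - (l + l'))) * τ₁ (x - δ • l')) = 0 := by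
  have e1 : α ⬝ᵥ phi = 0 := by rw [dotProduct_comm, hα.orth]
  have e1' : β ⬝ᵥ phi = 0 := by rw [dotProduct_comm, hβ.orth]
  have e2 : l ⬝ᵥ phi = 1 := by rw [dotProduct_comm, hl.level]
  have e3 : l' ⬝ᵥ phi = 1 := by rw [dotProduct_comm, hl'.level]
  have e4 : l ⬝ᵥ α = 1 := by rw [dotProduct_comm, hl.root]
  have e5 : l' ⬝ᵥ α = 1 := by rw [dotProduct_comm, hl'.root]
  have e6 : l ⬝ᵥ β = 1 := by rw [dotProduct_comm, hlb.root]
  have e7 : l' ⬝ᵥ β = 1 := by rw [dotProduct_comm, hlb'.root]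
  have e8 : l' ⬝ᵥ l = 1 := by rw [dotProduct_comm, hll]
  have e9 : β ⬝ᵥ α = 1 := by rw [dotProduct_comm, hαβ]
  set c₀ : V := (1 / 2 : ℂ) • (β - α + l) with hc₀
  set c₁ : V := (1 / 2 : ℂ) • (α - β + l) with hc₁
  set c₂ : V := (1 / 2 : ℂ) • ((2 : ℂ) • phi + α + β - l - (2 : ℂ) • l') with hc₂
  have hF : IsCFrame ![c₀, c₁, c₂] := by
    apply IsCFrame.vec
    all_goals try simp only [hc₀, hc₁, hc₂, dotProduct_add, add_dotProduct, sub_dotProduct,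
      dotProduct_sub, smul_dotProduct, dotProduct_smul, smul_eq_mul, e1, e1', e2, e3, e4, e5, e6, e7,
      e8, e9, hα.orth, hα.norm, hβ.orth, hβ.norm, hαβ, hl.norm, hl'.norm, hl.level, hl'.level, hl.root,
      hl'.root, hlb.root, hlb'.root, hll, phi_dotProduct_phi]; norm_num
    · convert hl.mem using 1; module
    · convert E8Lattice.sub_mem hβ.mem hα.mem using 1; module
    · convert E8Lattice.sub_mem (E8Lattice.add_mem phi_mem hβ.mem) hl'.mem using 1; module
    · convert E8Lattice.sub_mem (E8Lattice.add_mem hl.mem hl'.mem)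
        (E8Lattice.add_mem phi_mem hα.mem) using 1; module
    · convert E8Lattice.sub_mem (E8Lattice.add_mem phi_mem hα.mem) hl'.mem using 1; module
    · convert E8Lattice.sub_mem (E8Lattice.add_mem hl.mem hl'.mem)
        (E8Lattice.add_mem phi_mem hβ.mem) using 1; module
  have hlev : ∀ i, phi ⬝ᵥ (![c₀, c₁, c₂] : Fin 3 → V) i = 1 / 2 := fun i => by
    fin_cases i <;> simp only [Fin.zero_eta, Fin.mk_one, Fin.reduceFinMk, Matrix.cons_val, hc₀, hc₁, hc₂, dotProduct_add, dotProduct_sub, dotProduct_smul, smul_eq_mul,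
      hα.orth, hβ.orth, hl.level, hl'.level, phi_dotProduct_phi] <;> norm_num
  -- Since `w + c₀ = φ + β` and `w + c₁ = φ + α`, translation by `-δw` places `τ₀` at the arguments
  -- it has in the weight equations of `β` and `α`.
  set w : V := (1 / 2 : ℂ) • ((2 : ℂ) • phi + α + β - l) with hw
  have hwp : phi ⬝ᵥ w = 3 / 2 := by
    simp only [hw, dotProduct_add, dotProduct_sub, dotProduct_smul, smul_eq_mul,
      hα.orth, hβ.orth, hl.level, phi_dotProduct_phi]; norm_num
  have hI' := hI _ hF hlev
  simp only [Matrix.cons_val] at hI'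
  have h := eventually_shift (κ := κ₂) (-(δ • w))
    (by rw [dotProduct_neg, dotProduct_smul, hwp, smul_eq_mul, ← hκ]; ring)
    (fun x => pm s c₁ c₂ x * (τ₀ (x - δ • c₀) * τ₁ (x + δ • c₀)) +
      pm s c₂ c₀ x * (τ₀ (x - δ • c₁) * τ₁ (x + δ • c₁)) +
      pm s c₀ c₁ x * (τ₀ (x - δ • c₂) * τ₁ (x + δ • c₂)) = 0) hI'
  filter_upwards [h] with x hx
  have p1 : (x : V) + -(δ • w) - δ • c₀ = x - δ • (phi + β) := by rw [hw, hc₀]; module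
  have p2 : (x : V) + -(δ • w) + δ • c₀ = x - δ • (phi + α - l) := by rw [hw, hc₀]; module
  have p3 : (x : V) + -(δ • w) - δ • c₁ = x - δ • (phi + α) := by rw [hw, hc₁]; module
  have p4 : (x : V) + -(δ • w) + δ • c₁ = x - δ • (phi + β - l) := by rw [hw, hc₁]; module
  have p5 : (x : V) + -(δ • w) - δ • c₂ = x - δ • (phi + phi + α + β - (l + l')) := by
    rw [hw, hc₂]; module
  have p6 : (x : V) + -(δ • w) + δ • c₂ = x - δ • l' := by rw [hw, hc₂]; module
  obtain ⟨q1, q2, q3, q4, q5, q6⟩ :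
      (c₁ + c₂) ⬝ᵥ ((x : V) + -(δ • w)) = (phi + α - l') ⬝ᵥ x - δ ∧
      (c₁ - c₂) ⬝ᵥ ((x : V) + -(δ • w)) = (l + l' - phi - β) ⬝ᵥ x ∧
      (c₂ + c₀) ⬝ᵥ ((x : V) + -(δ • w)) = (phi + β - l') ⬝ᵥ x - δ ∧
      (c₂ - c₀) ⬝ᵥ ((x : V) + -(δ • w)) = (phi + α - l - l') ⬝ᵥ x ∧
      (c₀ + c₁) ⬝ᵥ ((x : V) + -(δ • w)) = l ⬝ᵥ x - δ ∧
      (c₀ - c₁) ⬝ᵥ ((x : V) + -(δ • w)) = (β - α) ⬝ᵥ x := by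
    refine ⟨?_, ?_, ?_, ?_, ?_, ?_⟩ <;>
    · simp only [hw, hc₀, hc₁, hc₂, dotProduct_add, add_dotProduct, sub_dotProduct, dotProduct_neg,
        dotProduct_sub, smul_dotProduct, dotProduct_smul, smul_eq_mul, e1, e1', e2, e3, e4, e5, e6, e7,
        e8, e9, hα.orth, hα.norm, hβ.orth, hβ.norm, hαβ, hl.norm, hl.level, hl.root, hlb.root,
        phi_dotProduct_phi]
      ring
  simp only [pm, p1, p2, p3, p4, p5, p6, q1, q2, q3, q4, q5, q6] at hx
  linear_combination hx

/-- Passage from a root to a linked root. -/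
theorem WeightEq.of_linked (hs : IsBracket s) (hτ₀ : ¬ τ₀.IsZero) (h01 : κ₀ + δ = κ₁)
    (h12 : κ₁ + δ = κ₂) {κ : ℂ} (hκ : κ + 3 / 2 * δ = κ₂) (hI : HirotaI s δ κ τ₀ τ₁) {α β l l' : V}
    (hα : IsE7Root α) (hβ : IsE7Root β) (hαβ : α ⬝ᵥ β = 1) (hl : IsWeight α l) (hl' : IsWeight α l')
    (hlb : IsWeight β l) (hlb' : IsWeight β l') (hll : l ⬝ᵥ l' = 1)
    (h : WeightEq s δ τ₀ τ₁ τ₂ α l l') : WeightEq s δ τ₀ τ₁ τ₂ β l l' := by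
  have e8 : l' ⬝ᵥ l = 1 := by rw [dotProduct_comm, hll]
  have e1 : α ⬝ᵥ phi = 0 := by rw [dotProduct_comm, hα.orth]
  have e2 : l ⬝ᵥ phi = 1 := by rw [dotProduct_comm, hl.level]
  have e3 : l' ⬝ᵥ phi = 1 := by rw [dotProduct_comm, hl'.level]
  have e4 : l ⬝ᵥ α = 1 := by rw [dotProduct_comm, hl.root]
  have e5 : l' ⬝ᵥ α = 1 := by rw [dotProduct_comm, hl'.root]
  have hne := eventually_shift (κ := κ₂) (-(δ • (phi + α)))
    (by rw [dotProduct_neg, dotProduct_smul, dotProduct_add, hα.orth, phi_dotProduct_phi, ← h12, ← h01,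
      smul_eq_mul]; ring) (fun y => τ₀ y ≠ 0)
      (MeroFun.eventually_ne_zero hτ₀)
  filter_upwards [h, hI.weightEq hκ hα hβ hαβ hl hl' hlb hlb' hll,
    hI.weightEq hκ hα hβ hαβ hl' hl hlb' hlb e8, hne,
    hs.eventually_ne_zero (κ := κ₂) (r := l + l' - phi - α)
      (by simp only [dotProduct_add, dotProduct_sub, hα.orth, hl.level, hl'.level, phi_dotProduct_phi]
          norm_num)
      (by simp only [dotProduct_add, dotProduct_sub, add_dotProduct, sub_dotProduct, hα.orth, hl.level,
            hl'.level, phi_dotProduct_phi, hα.norm, hl.norm, hl'.norm, hl.root, hl'.root, hll, e1, e2,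
            e3, e4, e5, e8]
          norm_num) 0] with x hx h1 h2 hne1 hne2
  unfold WeightEqAt at *
  rw [add_zero] at hne2
  rw [← sub_eq_add_neg] at hne1
  apply mul_left_cancel₀ (mul_ne_zero hne2 hne1)
  have r1 : s ((phi + α - l - l') ⬝ᵥ (x : V)) = -s ((l + l' - phi - α) ⬝ᵥ (x : V)) := by
    rw [← hs.neg]; congr 1
    simp only [add_dotProduct, sub_dotProduct]; ring
  have r2 : s ((phi + α - l' - l) ⬝ᵥ (x : V)) = -s ((l + l' - phi - α) ⬝ᵥ (x : V)) := by
    rw [← hs.neg]; congr 1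
    simp only [add_dotProduct, sub_dotProduct]; ring
  rw [r1] at h1
  rw [add_comm l' l, r2] at h2
  -- The two equations (I) contain the same third value of `τ₀`, absent from both weight equations;
  -- these multipliers cancel it. What remains trades `τ₀(x - δ(φ+α))` for `τ₀(x - δ(φ+β))` in each
  -- term on the right of the equation for `α`.
  linear_combination s ((l + l' - phi - β) ⬝ᵥ (x : V)) * τ₀ (x - δ • (phi + β)) * hx +
    s (l' ⬝ᵥ (x : V) - δ) * τ₁ (x - δ • l) * h1 - s (l ⬝ᵥ (x : V) - δ) * τ₁ (x - δ • l') * h2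

theorem isMate_of_weight {α l : V} (hα : IsE7Root α) (hl : IsWeight α l) :
    IsMate ((1 / 2 : ℂ) • (phi + α)) (l - (1 / 2 : ℂ) • (phi + α)) := by
  have e1 : α ⬝ᵥ phi = 0 := by rw [dotProduct_comm, hα.orth]
  have e2 : l ⬝ᵥ phi = 1 := by rw [dotProduct_comm, hl.level]
  have e4 : l ⬝ᵥ α = 1 := by rw [dotProduct_comm, hl.root]
  refine ⟨?_, ?_, ?_, ?_⟩
  · simp only [dotProduct_add, dotProduct_sub, add_dotProduct, sub_dotProduct, smul_dotProduct,
      dotProduct_smul, smul_eq_mul, hα.orth, hl.level, phi_dotProduct_phi, hα.norm, hl.norm, hl.root,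
      e1, e2, e4]; norm_num
  · simp only [dotProduct_add, dotProduct_sub, dotProduct_smul, smul_eq_mul, hα.orth, hl.level,
      phi_dotProduct_phi]; norm_num
  · convert hl.mem using 1; module
  · convert E8Lattice.sub_mem (E8Lattice.add_mem phi_mem hα.mem) hl.mem using 1; module

theorem mate_orthogonal {α l l' : V} (hα : IsE7Root α) (hl : IsWeight α l) (hl' : IsWeight α l')
    (hll : l ⬝ᵥ l' = 1) :
    (l - (1 / 2 : ℂ) • (phi + α)) ⬝ᵥ (l' - (1 / 2 : ℂ) • (phi + α)) = 0 := by
  simpa using (hα.isCFrame hl hl' hll).orthonormal 1 2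

/-- One equation of type (II₁) implies all of them. -/
theorem hirotaII1_of_weightEq (hs : IsBracket s) (hτ₀ : ¬ τ₀.IsZero) (h01 : κ₀ + δ = κ₁)
    (h12 : κ₁ + δ = κ₂) {κ : ℂ} (hκ : κ + 3 / 2 * δ = κ₂) (hI : HirotaI s δ κ τ₀ τ₁)
    (h0 : HirotaII0 s δ τ₁) {l l' : V} (hl : IsWeight (e 0 - e 1) l) (hl' : IsWeight (e 0 - e 1) l')
    (hll : l ⬝ᵥ l' = 1) (h : WeightEq s δ τ₀ τ₁ τ₂ (e 0 - e 1) l l') : HirotaII1 s δ τ₀ τ₁ τ₂ := by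
  -- The inductive property covers all mates of a root, because the pair of weights shared with the
  -- next root varies from link to link.
  have hQ : ∀ {α}, IsE7Root α → ∀ b c, IsMate ((1 / 2 : ℂ) • (phi + α)) b →
      IsMate ((1 / 2 : ℂ) • (phi + α)) c → EqII1 s δ τ₀ τ₁ τ₂ ((1 / 2 : ℂ) • (phi + α)) b c := by
    intro α hα
    refine IsE7Root.induction (Q := fun α => ∀ b c, IsMate ((1 / 2 : ℂ) • (phi + α)) b →
      IsMate ((1 / 2 : ℂ) • (phi + α)) c → EqII1 s δ τ₀ τ₁ τ₂ ((1 / 2 : ℂ) • (phi + α)) b c) ?_ ?_ hα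
    · rintro α β hα hβ ⟨hαβ, l, l', hl, hl', hlb, hlb', hll⟩ hQα b c hb hc
      have h1 := (eqII1_iff_weightEq h12 hα hl hl').1
        (hQα _ _ (isMate_of_weight hα hl) (isMate_of_weight hα hl'))
      have h2 := h1.of_linked hs hτ₀ h01 h12 hκ hI hα hβ hαβ hl hl' hlb hlb' hll
      exact ((eqII1_iff_weightEq h12 hβ hlb hlb').2 h2).of_mates hs h0 (isMate_of_weight hβ hlb)
        (isMate_of_weight hβ hlb') (mate_orthogonal hβ hlb hlb' hll) hb hc
    · intro b c hb hc
      have hα := isE7Root_e_sub_e (i := 0) (j := 1) (by decide)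
      exact ((eqII1_iff_weightEq h12 hα hl hl').2 h).of_mates hs h0 (isMate_of_weight hα hl)
        (isMate_of_weight hα hl') (mate_orthogonal hα hl hl' hll) hb hc
  intro a ha ha0 ha1 ha2
  have hα : IsE7Root ((2 : ℂ) • a 0 - phi) := by
    have n0 := ha.orthonormal 0 0
    simp only [if_true] at n0
    have := dotProduct_comm (a 0) phi
    refine ⟨E8Lattice.sub_mem (ha.two_smul_mem 0) phi_mem, ?_, ?_⟩
    · rw [dotProduct_sub_self, smul_dotProduct, dotProduct_smul, smul_dotProduct, this, ha0, n0,
        phi_dotProduct_phi]; norm_num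
    · rw [dotProduct_sub, dotProduct_smul, ha0, phi_dotProduct_phi]; norm_num
  have e : (1 / 2 : ℂ) • (phi + ((2 : ℂ) • a 0 - phi)) = a 0 := by module
  have := hQ hα (a 1) (a 2)
  rw [e] at this
  exact this ⟨by simp [ha.orthonormal], ha1, ha.add_mem 0 1 (by decide), ha.sub_mem 0 1 (by decide)⟩
    ⟨by simp [ha.orthonormal], ha2, ha.add_mem 0 2 (by decide), ha.sub_mem 0 2 (by decide)⟩

theorem isMeromorphicAt_bracket (hs : IsBracket s) {κ : ℂ} (r : V) (d : ℂ) (p : Hyp κ) :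
    IsMeromorphicAt (fun x : Hyp κ => s (r ⬝ᵥ x - d)) p := by
  apply IsMeromorphicAt.of_analyticAt (g := fun y => s (r ⬝ᵥ y - d))
  exact AnalyticAt.fun_comp (g := s) (hs.analyticAt _) ((analyticAt_dotProduct r _).sub analyticAt_const)

theorem MeroFun.isMeromorphicAt_sub {κ κ' : ℂ} (τ : MeroFun κ') {v : V} (hv : κ - phi ⬝ᵥ v = κ')
    (p : Hyp κ) : IsMeromorphicAt (fun x : Hyp κ => τ (x - v)) p := by
  simp only [sub_eq_add_neg]
  exact τ.isMeromorphicAt_add (by rw [dotProduct_neg, ← hv]; ring) p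

/-- A single equation of type (II₁) can be solved. -/
theorem exists_weightEq (hs : IsBracket s) (hτ₀ : ¬ τ₀.IsZero) (h01 : κ₀ + δ = κ₁)
    (h12 : κ₁ + δ = κ₂) {α l l' : V} (hα : IsE7Root α) (hl : IsWeight α l) (hl' : IsWeight α l')
    (hll : l ⬝ᵥ l' = 1) : ∃ τ₂ : MeroFun κ₂, WeightEq s δ τ₀ τ₁ τ₂ α l l' := by
  have e1 : α ⬝ᵥ phi = 0 := by rw [dotProduct_comm, hα.orth]
  have e2 : l ⬝ᵥ phi = 1 := by rw [dotProduct_comm, hl.level]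
  have e3 : l' ⬝ᵥ phi = 1 := by rw [dotProduct_comm, hl'.level]
  have e4 : l ⬝ᵥ α = 1 := by rw [dotProduct_comm, hl.root]
  have e5 : l' ⬝ᵥ α = 1 := by rw [dotProduct_comm, hl'.root]
  have e8 : l' ⬝ᵥ l = 1 := by rw [dotProduct_comm, hll]
  have v0 : κ₂ - phi ⬝ᵥ (δ • (phi + α)) = κ₀ := by
    rw [dotProduct_smul, dotProduct_add, hα.orth, phi_dotProduct_phi, ← h12, ← h01, smul_eq_mul]; ring
  have v1 : ∀ l, phi ⬝ᵥ l = 1 → κ₂ - phi ⬝ᵥ (δ • l) = κ₁ := fun l hl => by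
    rw [dotProduct_smul, hl, ← h12, smul_eq_mul]; ring
  have v2 : ∀ l, phi ⬝ᵥ l = 1 → phi ⬝ᵥ (phi + α - l) = 1 := fun l hl => by
    rw [dotProduct_sub, dotProduct_add, hl, hα.orth, phi_dotProduct_phi]; norm_num
  -- The coefficient of `τ₂ x`. The terms `- 0` give the brackets the form required by
  -- `isMeromorphicAt_bracket`.
  let D : Hyp κ₂ → ℂ := fun x => s ((l - l') ⬝ᵥ x - 0) * s ((l + l' - phi - α) ⬝ᵥ x - 0) *
    τ₀ (x - δ • (phi + α))
  have hD0 : ∀ᶠ x in generic (Hyp κ₂), D x ≠ 0 := by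
    have hne := eventually_shift (κ := κ₂) (-(δ • (phi + α)))
      (by rw [dotProduct_neg, ← v0]; ring) (fun y => τ₀ y ≠ 0)
      (MeroFun.eventually_ne_zero hτ₀)
    filter_upwards [hne, hs.eventually_ne_zero (κ := κ₂) (r := l - l')
        (by rw [dotProduct_sub, hl.level, hl'.level, sub_self])
        (by rw [dotProduct_sub_self, hl.norm, hl'.norm, hll]; norm_num) 0,
      hs.eventually_ne_zero (κ := κ₂) (r := l + l' - phi - α)
        (by simp only [dotProduct_add, dotProduct_sub, hα.orth, hl.level, hl'.level,
              phi_dotProduct_phi]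
            norm_num)
        (by simp only [dotProduct_add, dotProduct_sub, add_dotProduct, sub_dotProduct, hα.orth,
              hl.level, hl'.level, phi_dotProduct_phi, hα.norm, hl.norm, hl'.norm, hl.root, hl'.root,
              hll, e1, e2, e3, e4, e5, e8]
            norm_num) 0] with x h1 h2 h3
    rw [← sub_eq_add_neg] at h1
    rw [add_zero] at h2 h3
    simp only [D, sub_zero]
    exact mul_ne_zero (mul_ne_zero h2 h3) h1
  let F : Hyp κ₂ → ℂ := fun x =>
    (s (l' ⬝ᵥ x - δ) * s ((phi + α - l') ⬝ᵥ x - δ) * (τ₁ (x - δ • l) * τ₁ (x - δ • (phi + α - l))) -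
      s (l ⬝ᵥ x - δ) * s ((phi + α - l) ⬝ᵥ x - δ) *
        (τ₁ (x - δ • l') * τ₁ (x - δ • (phi + α - l')))) * (D x)⁻¹
  have hb := fun r d p => isMeromorphicAt_bracket hs (κ := κ₂) r d p
  have hF : ∀ p, IsMeromorphicAt F p := fun p =>
    ((((hb _ _ p).mul (hb _ _ p)).mul ((τ₁.isMeromorphicAt_sub (v1 _ hl.level) p).mul
      (τ₁.isMeromorphicAt_sub (v1 _ (v2 _ hl.level)) p))).sub
    (((hb _ _ p).mul (hb _ _ p)).mul ((τ₁.isMeromorphicAt_sub (v1 _ hl'.level) p).mul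
      (τ₁.isMeromorphicAt_sub (v1 _ (v2 _ hl'.level)) p)))).mul
    ((((hb _ _ p).mul (hb _ _ p)).mul (τ₀.isMeromorphicAt_sub v0 p)).inv hD0)
  refine ⟨⟨F, F, hF, rfl⟩, ?_⟩
  filter_upwards [MeroFun.eval_eq ⟨F, F, hF, rfl⟩ F rfl, hD0] with x hx hne
  unfold WeightEqAt
  rw [hx]
  simp only [F, D, sub_zero] at hne ⊢
  have h1 := left_ne_zero_of_mul (left_ne_zero_of_mul hne)
  have h2 := right_ne_zero_of_mul (left_ne_zero_of_mul hne)
  have h3 := right_ne_zero_of_mul hne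
  field_simp

end

/-! ### Consequences of (II₁): uniqueness, (II₂), and (I) and (II₀) at the next level. -/

theorem IsCFrame.add_mem_of_ne {a : Fin 3 → V} (ha : IsCFrame a) {i j : Fin 3} (h : i ≠ j) :
    a i + a j ∈ E8Lattice := by
  rcases lt_or_gt_of_ne h with h | h
  · exact ha.add_mem i j h
  · rw [add_comm]; exact ha.add_mem j i h

theorem IsCFrame.sub_mem_of_ne {a : Fin 3 → V} (ha : IsCFrame a) {i j : Fin 3} (h : i ≠ j) :
    a i - a j ∈ E8Lattice := by
  rcases lt_or_gt_of_ne h with h | h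
  · exact ha.sub_mem i j h
  · rw [← neg_sub]; exact E8Lattice.neg_mem (ha.sub_mem j i h)

theorem IsCFrame.norm {a : Fin 3 → V} (ha : IsCFrame a) (i : Fin 3) : a i ⬝ᵥ a i = 1 := by
  rw [ha.orthonormal, if_pos rfl]

theorem IsCFrame.orth {a : Fin 3 → V} (ha : IsCFrame a) {i j : Fin 3} (h : i ≠ j) :
    a i ⬝ᵥ a j = 0 := by
  rw [ha.orthonormal, if_neg h]

section

variable {s : ℂ → ℂ} {δ κ₀ κ₁ κ₂ : ℂ} {τ₀ : MeroFun κ₀} {τ₁ : MeroFun κ₁} {τ₂ : MeroFun κ₂}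

theorem HirotaII1.weightEq (h12 : κ₁ + δ = κ₂) (h : HirotaII1 s δ τ₀ τ₁ τ₂) {α l l' : V}
    (hα : IsE7Root α) (hl : IsWeight α l) (hl' : IsWeight α l') (hll : l ⬝ᵥ l' = 1) :
    WeightEq s δ τ₀ τ₁ τ₂ α l l' := by
  have hm := isMate_of_weight hα hl
  have hm' := isMate_of_weight hα hl'
  have h0 : phi ⬝ᵥ ((1 / 2 : ℂ) • (phi + α)) = 1 := by
    simp only [dotProduct_smul, dotProduct_add, hα.orth, phi_dotProduct_phi, smul_eq_mul]; norm_num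
  have h3 := h _ (hα.isCFrame hl hl' hll) h0 hm.orth hm'.orth
  simp only [Matrix.cons_val] at h3
  exact (eqII1_iff_weightEq h12 hα hl hl').1 h3

/-- The equation of the single root `e 0 - e 1` suffices, as the coefficient of `τ₂` in it is
generically nonzero. -/
theorem HirotaII1.unique (hs : IsBracket s) (hτ₀ : ¬ τ₀.IsZero) (h01 : κ₀ + δ = κ₁)
    (h12 : κ₁ + δ = κ₂) {τ₂' : MeroFun κ₂} (h : HirotaII1 s δ τ₀ τ₁ τ₂)
    (h' : HirotaII1 s δ τ₀ τ₁ τ₂') : τ₂ = τ₂' := by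
  obtain ⟨l, l', hl, hl', hll⟩ := exists_weights
  have hα := isE7Root_e_sub_e (i := 0) (j := 1) (by decide)
  have hm := isMate_of_weight hα hl
  have hm' := isMate_of_weight hα hl'
  have hne := eventually_shift (κ := κ₁) (-(δ • (1 / 2 : ℂ) • (phi + (e 0 - e 1))))
    (by rw [dotProduct_neg, dotProduct_smul, dotProduct_smul, dotProduct_add, hα.orth,
          phi_dotProduct_phi, ← h01, smul_eq_mul, smul_eq_mul]; ring)
    (fun y => τ₀ y ≠ 0) (MeroFun.eventually_ne_zero hτ₀)
  have key : ∀ᶠ y : Hyp κ₁ in generic (Hyp κ₁),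
      τ₂ (y + δ • (1 / 2 : ℂ) • (phi + (e 0 - e 1))) =
        τ₂' (y + δ • (1 / 2 : ℂ) • (phi + (e 0 - e 1))) := by
    filter_upwards [(eqII1_iff_weightEq h12 hα hl hl').2 (h.weightEq h12 hα hl hl' hll),
      (eqII1_iff_weightEq h12 hα hl hl').2 (h'.weightEq h12 hα hl hl' hll), hne,
      hs.eventually_pm_ne_zero hm.norm hm'.norm (mate_orthogonal hα hl hl' hll) hm.orth hm'.orth]
      with y h1 h2 h3 h4
    rw [← sub_eq_add_neg] at h3
    unfold EqII1At at h1 h2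
    apply mul_left_cancel₀ (mul_ne_zero h4 h3)
    linear_combination h1 - h2
  have := eventually_shift (κ := κ₂) (-(δ • (1 / 2 : ℂ) • (phi + (e 0 - e 1))))
    (by rw [dotProduct_neg, dotProduct_smul, dotProduct_smul, dotProduct_add, hα.orth,
          phi_dotProduct_phi, ← h12, smul_eq_mul, smul_eq_mul]; ring)
    (fun y => τ₂ (y + δ • (1 / 2 : ℂ) • (phi + (e 0 - e 1))) =
        τ₂' (y + δ • (1 / 2 : ℂ) • (phi + (e 0 - e 1)))) key
  apply MeroFun.ext_of_eventually
  filter_upwards [this] with x hx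
  rwa [neg_add_cancel_right] at hx

/-- With a fourth vector `b` orthogonal to `φ`, the equations (II₁) of `(a₀, a₂, b)` and `(a₁, a₂,
b)` share the values `τ₁(x ± δb)`. Their elimination and the three-term relation give (II₂) times
`[(a₂ ± b|x)]`. -/
theorem HirotaII1.hirotaII2 (hs : IsBracket s) (h : HirotaII1 s δ τ₀ τ₁ τ₂) :
    HirotaII2 s δ τ₀ τ₁ τ₂ := by
  intro a ha h0 h1 h2
  have n01 := ha.orth (i := 0) (j := 1) (by decide)
  have n02 := ha.orth (i := 0) (j := 2) (by decide)
  have n12 := ha.orth (i := 1) (j := 2) (by decide)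
  -- The lattice vector `φ - (a 0 + a 1)` has norm `2 - 4 + 2 = 0`.
  have hphi : phi = a 0 + a 1 := by
    rw [← sub_eq_zero]
    apply eq_zero_of_dotProduct_self (E8Lattice.sub_mem phi_mem (ha.add_mem 0 1 (by decide)))
    rw [dotProduct_sub_self, dotProduct_add_self, dotProduct_add, h0, h1, n01, ha.norm, ha.norm,
      phi_dotProduct_phi]
    norm_num
  obtain ⟨b, hb, hb0⟩ := ha.exists_extends_of_one_one hphi
  have f0 := h ![a 0, a 2, b] (IsCFrame.vec (ha.norm 0) (ha.norm 2) hb.norm n02 (hb.orth 0) (hb.orth 2)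
    (ha.add_mem 0 2 (by decide)) (ha.sub_mem 0 2 (by decide)) (hb.add_mem 0) (hb.sub_mem 0)
    (hb.add_mem 2) (hb.sub_mem 2)) h0 h2 hb0
  have f1 := h ![a 1, a 2, b] (IsCFrame.vec (ha.norm 1) (ha.norm 2) hb.norm n12 (hb.orth 1) (hb.orth 2)
    (ha.add_mem 1 2 (by decide)) (ha.sub_mem 1 2 (by decide)) (hb.add_mem 1) (hb.sub_mem 1)
    (hb.add_mem 2) (hb.sub_mem 2)) h1 h2 hb0
  simp only [Matrix.cons_val] at f0 f1
  filter_upwards [f0, f1, hs.eventually_pm_ne_zero (ha.norm 2) hb.norm (hb.orth 2) h2 hb0]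
    with x hx0 hx1 hne
  apply mul_left_cancel₀ hne
  have h3 := hs.pm_three_term (a 0) (a 1) (a 2) b x
  rw [hs.pm_swap (a 1) b] at h3
  rw [hs.pm_swap (a 0) (a 1)]
  linear_combination pm s (a 1) (a 2) x * hx0 - pm s (a 0) (a 2) x * hx1 +
    (τ₁ (x + δ • a 2) * τ₁ (x - δ • a 2)) * h3

/-- The weight equation of the root `a i - b` with weights `a i + a j` and `a i + a k`, translated
by `δ (a i)`. The value `τ₀(z - δ(φ-b))` does not depend on `i`, so the three cyclic versions can be
added. -/
theorem HirotaII1.term_hirotaI (h12 : κ₁ + δ = κ₂) (h : HirotaII1 s δ τ₀ τ₁ τ₂) {κ : ℂ}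
    (hκ : κ + δ / 2 = κ₂) {a : Fin 3 → V} (ha : IsCFrame a) (ha2 : ∀ i, phi ⬝ᵥ a i = 1 / 2) {b : V}
    (hb : ExtendsFrame a b) (hb2 : phi ⬝ᵥ b = 1 / 2) {i j k : Fin 3} (hij : i ≠ j) (hik : i ≠ k)
    (hjk : j ≠ k) :
    ∀ᶠ z : Hyp κ in generic (Hyp κ),
      s ((a j - a k) ⬝ᵥ z) * s ((a i + a j + a k + b - phi) ⬝ᵥ z + δ / 2) *
        (τ₀ (z - δ • (phi - b)) * τ₂ (z + δ • a i)) =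
      s ((a i + a k) ⬝ᵥ z) * s ((phi - a k - b) ⬝ᵥ z - δ / 2) *
        (τ₁ (z - δ • a j) * τ₁ (z - δ • (phi - b - (a i + a j)))) -
      s ((a i + a j) ⬝ᵥ z) * s ((phi - a j - b) ⬝ᵥ z - δ / 2) *
        (τ₁ (z - δ • a k) * τ₁ (z - δ • (phi - b - (a i + a k)))) := by
  have nb : ∀ i, b ⬝ᵥ a i = 0 := fun i => by rw [dotProduct_comm, hb.orth]
  have hα : IsE7Root (a i - b) := by
    refine ⟨hb.sub_mem i, ?_, by rw [dotProduct_sub, ha2, hb2, sub_self]⟩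
    rw [dotProduct_sub_self, ha.norm, hb.norm, hb.orth]; norm_num
  have hw : ∀ {j}, i ≠ j → IsWeight (a i - b) (a i + a j) := fun {j} hij => by
    refine ⟨ha.add_mem_of_ne hij, ?_, ?_, ?_⟩
    · rw [dotProduct_add_self, ha.norm, ha.norm, ha.orth hij]; norm_num
    · rw [dotProduct_add, ha2, ha2]; norm_num
    · simp only [sub_dotProduct, dotProduct_add, nb, ha.norm, ha.orth hij]; norm_num
  have hll : (a i + a j) ⬝ᵥ (a i + a k) = 1 := by
    simp only [add_dotProduct, dotProduct_add, ha.norm, ha.orth hij.symm, ha.orth hik, ha.orth hjk]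
    norm_num
  have := eventually_shift (κ := κ) (δ • a i) (by rw [dotProduct_smul, ha2, ← hκ, smul_eq_mul]; ring)
    (WeightEqAt s δ τ₀ τ₁ τ₂ (a i - b) (a i + a j) (a i + a k))
    (h.weightEq h12 hα (hw hij) (hw hik) hll)
  filter_upwards [this] with z hz
  have p1 : (z : V) + δ • a i - δ • (phi + (a i - b)) = z - δ • (phi - b) := by module
  have p2 : ∀ j, (z : V) + δ • a i - δ • (a i + a j) = z - δ • a j := fun j => by module
  have p3 : ∀ j, (z : V) + δ • a i - δ • (phi + (a i - b) - (a i + a j)) =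
      z - δ • (phi - b - (a i + a j)) := fun j => by module
  have q1 : (a i + a j - (a i + a k)) ⬝ᵥ ((z : V) + δ • a i) = (a j - a k) ⬝ᵥ z := by
    simp only [add_dotProduct, sub_dotProduct, dotProduct_add, dotProduct_smul, smul_eq_mul,
      ha.orth hij.symm, ha.orth hik.symm]; ring
  have q2 : (a i + a j + (a i + a k) - phi - (a i - b)) ⬝ᵥ ((z : V) + δ • a i) =
      (a i + a j + a k + b - phi) ⬝ᵥ z + δ / 2 := by
    simp only [add_dotProduct, sub_dotProduct, dotProduct_add, dotProduct_smul, smul_eq_mul,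
      ha.orth hij.symm, ha.orth hik.symm, nb, ha.norm, ha2]; ring
  have q3 : ∀ {j}, i ≠ j → (a i + a j) ⬝ᵥ ((z : V) + δ • a i) - δ = (a i + a j) ⬝ᵥ z := fun {j} hij => by
    simp only [add_dotProduct, dotProduct_add, dotProduct_smul, smul_eq_mul,
      ha.orth hij.symm, ha.norm]; ring
  have q4 : ∀ {j}, i ≠ j → (phi + (a i - b) - (a i + a j)) ⬝ᵥ ((z : V) + δ • a i) - δ =
      (phi - a j - b) ⬝ᵥ z - δ / 2 := fun {j} hij => by
    simp only [add_dotProduct, sub_dotProduct, dotProduct_add, dotProduct_smul, smul_eq_mul,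
      ha.orth hij.symm, nb, ha.norm, ha2]; ring
  unfold WeightEqAt at hz
  rwa [p1, p2, p2, p3, p3, q1, q2, q3 hij, q3 hik, q4 hij, q4 hik] at hz

/-- The version of `term_hirotaI` for `i` is multiplied by `[(a j + a k|z)] τ₁(z - δ (a i))`. In the
cyclic sum the six terms on the right cancel in pairs, and the left is (I) times a generically
nonzero factor. -/
theorem HirotaII1.hirotaI (hs : IsBracket s) (hτ₀ : ¬ τ₀.IsZero) (h01 : κ₀ + δ = κ₁)
    (h12 : κ₁ + δ = κ₂) (h : HirotaII1 s δ τ₀ τ₁ τ₂) {κ : ℂ} (hκ : κ + δ / 2 = κ₂) :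
    HirotaI s δ κ τ₁ τ₂ := by
  intro a ha ha2
  obtain ⟨b, hb, hb2⟩ := ha.exists_extends_of_half ha2
  have nb : ∀ i, b ⬝ᵥ a i = 0 := fun i => by rw [dotProduct_comm, hb.orth]
  have np : ∀ i, a i ⬝ᵥ phi = 1 / 2 := fun i => by rw [dotProduct_comm, ha2]
  have nbp : b ⬝ᵥ phi = 1 / 2 := by rw [dotProduct_comm, hb2]
  have hne := eventually_shift (κ := κ) (-(δ • (phi - b)))
    (by rw [dotProduct_neg, dotProduct_smul, dotProduct_sub, hb2, phi_dotProduct_phi, smul_eq_mul]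
        linear_combination hκ - h12 - h01) (fun y => τ₀ y ≠ 0) (MeroFun.eventually_ne_zero hτ₀)
  have hne' := hs.eventually_ne_zero (κ := κ) (r := a 0 + a 1 + a 2 + b - phi)
    (by simp only [dotProduct_add, dotProduct_sub, ha2, hb2, phi_dotProduct_phi]; norm_num)
    (by simp only [dotProduct_add, add_dotProduct, dotProduct_sub, sub_dotProduct, ha2, hb2, np, nbp,
          nb, hb.orth, hb.norm, ha.norm, ha.orth (show (0 : Fin 3) ≠ 1 by decide),
          ha.orth (show (0 : Fin 3) ≠ 2 by decide), ha.orth (show (1 : Fin 3) ≠ 2 by decide),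
          ha.orth (show (1 : Fin 3) ≠ 0 by decide), ha.orth (show (2 : Fin 3) ≠ 0 by decide),
          ha.orth (show (2 : Fin 3) ≠ 1 by decide), phi_dotProduct_phi]
        norm_num) (δ / 2)
  filter_upwards [h.term_hirotaI h12 hκ ha ha2 hb hb2 (i := 0) (j := 1) (k := 2) (by decide) (by decide)
      (by decide),
    h.term_hirotaI h12 hκ ha ha2 hb hb2 (i := 1) (j := 2) (k := 0) (by decide) (by decide) (by decide),
    h.term_hirotaI h12 hκ ha ha2 hb hb2 (i := 2) (j := 0) (k := 1) (by decide) (by decide) (by decide),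
    hne, hne'] with z h0 h1 h2 h3 h4
  rw [← sub_eq_add_neg] at h3
  rw [add_right_comm (a 1 + a 2), show a 1 + a 2 + b + a 0 = a 0 + a 1 + a 2 + b by abel,
    add_comm (a 1) (a 0)] at h1
  rw [show a 2 + a 0 + a 1 = a 0 + a 1 + a 2 by abel, add_comm (a 2) (a 0), add_comm (a 2) (a 1)] at h2
  apply mul_left_cancel₀ (mul_ne_zero h4 h3)
  simp only [pm, add_comm (a 2) (a 0)]
  linear_combination s ((a 1 + a 2) ⬝ᵥ (z : V)) * τ₁ (z - δ • a 0) * h0 +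
    s ((a 0 + a 2) ⬝ᵥ (z : V)) * τ₁ (z - δ • a 1) * h1 +
    s ((a 0 + a 1) ⬝ᵥ (z : V)) * τ₁ (z - δ • a 2) * h2

/-- The weight equation of the root `a i - b`, with the same weights `l`, `l'` and the same value of
`τ₀` for every `i`. -/
theorem HirotaII1.term_hirotaII0 (h12 : κ₁ + δ = κ₂) (h : HirotaII1 s δ τ₀ τ₁ τ₂)
    {a : Fin 3 → V} (ha : IsCFrame a) (ha0 : ∀ i, phi ⬝ᵥ a i = 0) {b l l' : V}
    (hb : ExtendsFrame a b) (hb0 : phi ⬝ᵥ b = 0) (hl : l ∈ E8Lattice) (hl' : l' ∈ E8Lattice)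
    (nl : l ⬝ᵥ l = 2) (nl' : l' ⬝ᵥ l' = 2) (vl : phi ⬝ᵥ l = 1) (vl' : phi ⬝ᵥ l' = 1)
    (al : ∀ i, a i ⬝ᵥ l = 1 / 2) (al' : ∀ i, a i ⬝ᵥ l' = 1 / 2) (bl : b ⬝ᵥ l = -1 / 2)
    (bl' : b ⬝ᵥ l' = -1 / 2) {i j k : Fin 3} (hij : i ≠ j) (hik : i ≠ k)
    (hsum : l + l' = phi + a i + a j + a k - b) :
    ∀ᶠ x : Hyp κ₂ in generic (Hyp κ₂),
      s ((l - l') ⬝ᵥ x) * s ((a j + a k) ⬝ᵥ x) * (τ₀ (x - δ • (phi - b)) * τ₂ (x + δ • a i)) =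
      s (l' ⬝ᵥ x - δ / 2) * s ((l - (a j + a k)) ⬝ᵥ x - δ / 2) *
        (τ₁ (x + δ • a i - δ • l) * τ₁ (x - δ • (phi - b - l))) -
      s (l ⬝ᵥ x - δ / 2) * s ((l' - (a j + a k)) ⬝ᵥ x - δ / 2) *
        (τ₁ (x + δ • a i - δ • l') * τ₁ (x - δ • (phi - b - l'))) := by
  have hα : IsE7Root (a i - b) := by
    refine ⟨hb.sub_mem i, ?_, by rw [dotProduct_sub, ha0, hb0, sub_self]⟩
    rw [dotProduct_sub_self, ha.norm, hb.norm, hb.orth]; norm_num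
  have hw : IsWeight (a i - b) l := ⟨hl, nl, vl, by rw [sub_dotProduct, al, bl]; norm_num⟩
  have hw' : IsWeight (a i - b) l' := ⟨hl', nl', vl', by rw [sub_dotProduct, al', bl']; norm_num⟩
  have la : ∀ i, l ⬝ᵥ a i = 1 / 2 := fun i => by rw [dotProduct_comm, al]
  have la' : ∀ i, l' ⬝ᵥ a i = 1 / 2 := fun i => by rw [dotProduct_comm, al']
  have hll : l ⬝ᵥ l' = 1 := by
    have h1 : (l + l') ⬝ᵥ l' = (phi + a i + a j + a k - b) ⬝ᵥ l' := by rw [hsum]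
    simp only [add_dotProduct, sub_dotProduct, nl', vl', al', bl'] at h1
    linear_combination h1
  have := eventually_shift (κ := κ₂) (δ • a i) (by rw [dotProduct_smul, ha0, smul_zero, add_zero])
    (WeightEqAt s δ τ₀ τ₁ τ₂ (a i - b) l l') (h.weightEq h12 hα hw hw' hll)
  filter_upwards [this] with x hx
  have p1 : (x : V) + δ • a i - δ • (phi + (a i - b)) = x - δ • (phi - b) := by module
  have p3 : ∀ l, (x : V) + δ • a i - δ • (phi + (a i - b) - l) =
      x - δ • (phi - b - l) := fun j => by module
  have r1 : l + l' - phi - (a i - b) = a j + a k := by rw [hsum]; abel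
  have r2 : phi + (a i - b) - l' = l - (a j + a k) := by rw [← r1]; abel
  have r3 : phi + (a i - b) - l = l' - (a j + a k) := by rw [← r1]; abel
  have q1 : (l - l') ⬝ᵥ ((x : V) + δ • a i) = (l - l') ⬝ᵥ x := by
    simp only [sub_dotProduct, dotProduct_add, dotProduct_smul, smul_eq_mul, la, la']; ring
  have q2 : (a j + a k) ⬝ᵥ ((x : V) + δ • a i) = (a j + a k) ⬝ᵥ x := by
    simp only [add_dotProduct, dotProduct_add, dotProduct_smul, smul_eq_mul, ha.orth hij.symm,
      ha.orth hik.symm]; ring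
  have q3 : ∀ {l : V}, l ⬝ᵥ a i = 1 / 2 → l ⬝ᵥ ((x : V) + δ • a i) - δ = l ⬝ᵥ x - δ / 2 :=
    fun {l} la => by
      simp only [dotProduct_add, dotProduct_smul, smul_eq_mul, la]; ring
  have q4 : ∀ {l : V}, l ⬝ᵥ a i = 1 / 2 → (l - (a j + a k)) ⬝ᵥ a i = 1 / 2 := fun {l} la => by
    simp only [sub_dotProduct, add_dotProduct, la, ha.orth hij.symm, ha.orth hik.symm]; norm_num
  unfold WeightEqAt at hx
  rw [p1, p3, p3, r1, r2, r3, q1, q2, q3 (la i), q3 (la' i), q3 (q4 (la i)), q3 (q4 (la' i))] at hx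
  exact hx

/-- The equation of type (I) for the frame `{±(l/2 - a i)}`. -/
theorem HirotaI.half_frame (hs : IsBracket s) {κ : ℂ} (hκ : κ + δ / 2 = κ₂) (hI : HirotaI s δ κ τ₁ τ₂)
    {a : Fin 3 → V} (ha : IsCFrame a) (ha0 : ∀ i, phi ⬝ᵥ a i = 0) {l : V}
    (hl : l ∈ E8Lattice) (nl : l ⬝ᵥ l = 2) (vl : phi ⬝ᵥ l = 1) (al : ∀ i, a i ⬝ᵥ l = 1 / 2) :
    ∀ᶠ x : Hyp κ₂ in generic (Hyp κ₂),
      s ((l - (a 1 + a 2)) ⬝ᵥ x - δ / 2) * s ((a 1 - a 2) ⬝ᵥ x) *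
        (τ₁ (x + δ • a 0 - δ • l) * τ₂ (x - δ • a 0)) +
      s ((l - (a 2 + a 0)) ⬝ᵥ x - δ / 2) * s ((a 2 - a 0) ⬝ᵥ x) *
        (τ₁ (x + δ • a 1 - δ • l) * τ₂ (x - δ • a 1)) +
      s ((l - (a 0 + a 1)) ⬝ᵥ x - δ / 2) * s ((a 0 - a 1) ⬝ᵥ x) *
        (τ₁ (x + δ • a 2 - δ • l) * τ₂ (x - δ • a 2)) = 0 := by
  have la : ∀ i, l ⬝ᵥ a i = 1 / 2 := fun i => by rw [dotProduct_comm, al]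
  have hdot : ∀ i j, ((1 / 2 : ℂ) • l - a i) ⬝ᵥ ((1 / 2 : ℂ) • l - a j) = if i = j then 1 else 0 := by
    intro i j
    simp only [sub_dotProduct, dotProduct_sub, smul_dotProduct, dotProduct_smul, smul_eq_mul, la, al,
      nl, ha.orthonormal]
    ring
  have hadd : ∀ i j, i ≠ j → ((1 / 2 : ℂ) • l - a i) + ((1 / 2 : ℂ) • l - a j) ∈ E8Lattice :=
    fun i j hij => by
      convert E8Lattice.sub_mem hl (ha.add_mem_of_ne hij) using 1; module
  have hsub : ∀ i j, i ≠ j → ((1 / 2 : ℂ) • l - a i) - ((1 / 2 : ℂ) • l - a j) ∈ E8Lattice :=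
    fun i j hij => by
      convert ha.sub_mem_of_ne hij.symm using 1; module
  have hF : IsCFrame fun i => (1 / 2 : ℂ) • l - a i :=
    ⟨hdot, fun i j h => hadd i j h.ne, fun i j h => hsub i j h.ne, fun i => by
      convert E8Lattice.sub_mem hl (ha.two_smul_mem i) using 1; module⟩
  have hI' := hI _ hF fun i => by rw [dotProduct_sub, dotProduct_smul, vl, ha0]; simp
  beta_reduce at hI'
  have := eventually_shift (κ := κ₂) (-(δ • (1 / 2 : ℂ) • l))
    (by rw [dotProduct_neg, dotProduct_smul, dotProduct_smul, vl, ← hκ, smul_eq_mul, smul_eq_mul]; ring)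
    (fun x =>
      pm s ((1 / 2 : ℂ) • l - a 1) ((1 / 2 : ℂ) • l - a 2) x *
        (τ₁ (x - δ • ((1 / 2 : ℂ) • l - a 0)) * τ₂ (x + δ • ((1 / 2 : ℂ) • l - a 0))) +
      pm s ((1 / 2 : ℂ) • l - a 2) ((1 / 2 : ℂ) • l - a 0) x *
        (τ₁ (x - δ • ((1 / 2 : ℂ) • l - a 1)) * τ₂ (x + δ • ((1 / 2 : ℂ) • l - a 1))) +
      pm s ((1 / 2 : ℂ) • l - a 0) ((1 / 2 : ℂ) • l - a 1) x *
        (τ₁ (x - δ • ((1 / 2 : ℂ) • l - a 2)) * τ₂ (x + δ • ((1 / 2 : ℂ) • l - a 2))) = 0)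
    hI'
  filter_upwards [this] with x hx
  have p1 : ∀ i, (x : V) + -(δ • (1 / 2 : ℂ) • l) - δ • ((1 / 2 : ℂ) • l - a i) =
      x + δ • a i - δ • l := fun i => by module
  have p2 : ∀ i, (x : V) + -(δ • (1 / 2 : ℂ) • l) + δ • ((1 / 2 : ℂ) • l - a i) =
      x - δ • a i := fun i => by module
  have q : ∀ i j, pm s ((1 / 2 : ℂ) • l - a i) ((1 / 2 : ℂ) • l - a j)
      ((x : V) + -(δ • (1 / 2 : ℂ) • l)) =
      -(s ((l - (a i + a j)) ⬝ᵥ x - δ / 2) * s ((a i - a j) ⬝ᵥ x)) := fun i j => by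
    have q1 : ((1 / 2 : ℂ) • l - a i + ((1 / 2 : ℂ) • l - a j)) ⬝ᵥ ((x : V) + -(δ • (1 / 2 : ℂ) • l)) =
        (l - (a i + a j)) ⬝ᵥ x - δ / 2 := by
      simp only [add_dotProduct, sub_dotProduct, smul_dotProduct, dotProduct_add, dotProduct_neg,
        dotProduct_smul, smul_eq_mul, nl, al]; ring
    have q2 : ((1 / 2 : ℂ) • l - a i - ((1 / 2 : ℂ) • l - a j)) ⬝ᵥ ((x : V) + -(δ • (1 / 2 : ℂ) • l)) =
        -((a i - a j) ⬝ᵥ x) := by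
      simp only [sub_dotProduct, smul_dotProduct, dotProduct_add, dotProduct_neg,
        dotProduct_smul, smul_eq_mul, nl, al]; ring
    rw [pm, q1, q2, hs.neg]; ring
  simp only [p1, p2, q] at hx
  linear_combination -hx

/-- The versions of `term_hirotaII0`, multiplied by `[(a j - a k|x)] τ₂(x - δ (a i))`, add up on the
left to (II₀) times `[(l - l'|x)] τ₀(x - δ(φ-b))`. On the right they group into the expressions of
`half_frame` for `l` and for `l'`, which vanish by the equations (I) between `τ₁` and `τ₂`. -/
theorem HirotaII1.hirotaII0 (hs : IsBracket s) (hτ₀ : ¬ τ₀.IsZero) (h01 : κ₀ + δ = κ₁)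
    (h12 : κ₁ + δ = κ₂) (h : HirotaII1 s δ τ₀ τ₁ τ₂) {κ : ℂ} (hκ : κ + δ / 2 = κ₂) :
    HirotaII0 s δ τ₂ := by
  intro a ha ha0
  have hI := h.hirotaI hs hτ₀ h01 h12 hκ
  obtain ⟨b, l, l', hb, hb0, hl, hl', nl, nl', vl, vl', al, al', bl, bl', hsum⟩ :=
    ha.exists_extends_of_zero ha0
  have hll : l ⬝ᵥ l' = 1 := by
    have h1 : (l + l') ⬝ᵥ l' = (phi + a 0 + a 1 + a 2 - b) ⬝ᵥ l' := by rw [hsum]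
    simp only [add_dotProduct, sub_dotProduct, nl', vl', al', bl'] at h1
    linear_combination h1
  have hne := eventually_shift (κ := κ₂) (-(δ • (phi - b)))
    (by rw [dotProduct_neg, dotProduct_smul, dotProduct_sub, hb0, phi_dotProduct_phi, smul_eq_mul]
        linear_combination -h12 - h01) (fun y => τ₀ y ≠ 0) (MeroFun.eventually_ne_zero hτ₀)
  have hne' := hs.eventually_ne_zero (κ := κ₂) (r := l - l')
    (by rw [dotProduct_sub, vl, vl', sub_self])
    (by rw [dotProduct_sub_self, nl, nl', hll]; norm_num) 0
  filter_upwards [h.term_hirotaII0 h12 ha ha0 hb hb0 hl hl' nl nl' vl vl' al al' bl bl'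
      (i := 0) (j := 1) (k := 2) (by decide) (by decide) hsum,
    h.term_hirotaII0 h12 ha ha0 hb hb0 hl hl' nl nl' vl vl' al al' bl bl'
      (i := 1) (j := 2) (k := 0) (by decide) (by decide) (by rw [hsum]; abel),
    h.term_hirotaII0 h12 ha ha0 hb hb0 hl hl' nl nl' vl vl' al al' bl bl'
      (i := 2) (j := 0) (k := 1) (by decide) (by decide) (by rw [hsum]; abel),
    hI.half_frame hs hκ ha ha0 hl nl vl al, hI.half_frame hs hκ ha ha0 hl' nl' vl' al', hne, hne']
    with x h0 h1 h2 h3 h4 h5 h6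
  rw [← sub_eq_add_neg] at h5
  rw [add_zero] at h6
  apply mul_left_cancel₀ (mul_ne_zero h6 h5)
  simp only [pm]
  linear_combination s ((a 1 - a 2) ⬝ᵥ (x : V)) * τ₂ (x - δ • a 0) * h0 +
    s ((a 2 - a 0) ⬝ᵥ (x : V)) * τ₂ (x - δ • a 1) * h1 +
    s ((a 0 - a 1) ⬝ᵥ (x : V)) * τ₂ (x - δ • a 2) * h2 +
    s (l' ⬝ᵥ (x : V) - δ / 2) * τ₁ (x - δ • (phi - b - l)) * h3 -
    s (l ⬝ᵥ (x : V) - δ / 2) * τ₁ (x - δ • (phi - b - l')) * h4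

end

end ORG

/-! ### The recursion theorem. -/

theorem mainTheorem4 (s : ℂ → ℂ) (hs : ORG.IsBracket s) (δ : ℂ) (hδ : δ ≠ 0)
    (hδΩ : ∀ m : ℤ, s (m * δ) = 0 → m * δ = 0) (c : ℂ) (n : ℤ)
    (τ₀ : ORG.MeroFun (c + (n - 1) * δ)) (τ₁ : ORG.MeroFun (c + n * δ))
    (hτ₀ : ¬ τ₀.IsZero)
    (hA1 : ORG.HirotaI s δ (c + (n - 1 / 2) * δ) τ₀ τ₁)
    (hA2 : ORG.HirotaII0 s δ τ₁) :
    (∃! τ₂ : ORG.MeroFun (c + (n + 1) * δ), ORG.HirotaII1 s δ τ₀ τ₁ τ₂) ∧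
    ∀ τ₂ : ORG.MeroFun (c + (n + 1) * δ), ORG.HirotaII1 s δ τ₀ τ₁ τ₂ →
      ORG.HirotaII2 s δ τ₀ τ₁ τ₂ ∧
      ORG.HirotaI s δ (c + (n + 1 / 2) * δ) τ₁ τ₂ ∧
      ORG.HirotaII0 s δ τ₂ := by
  have h01 : c + (n - 1) * δ + δ = c + n * δ := by ring
  have h12 : c + n * δ + δ = c + (n + 1) * δ := by ring
  have hκ : c + (n - 1 / 2) * δ + 3 / 2 * δ = c + (n + 1) * δ := by ring
  have hκ' : c + (n + 1 / 2) * δ + δ / 2 = c + (n + 1) * δ := by ring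
  refine ⟨?_, fun τ₂ h => ⟨h.hirotaII2 hs, h.hirotaI hs hτ₀ h01 h12 hκ',
    h.hirotaII0 hs hτ₀ h01 h12 hκ'⟩⟩
  obtain ⟨l, l', hl, hl', hll⟩ := ORG.exists_weights
  obtain ⟨τ₂, h⟩ := ORG.exists_weightEq (τ₁ := τ₁) hs hτ₀ h01 h12
    (ORG.isE7Root_e_sub_e (i := 0) (j := 1) (by decide)) hl hl' hll
  have h2 := ORG.hirotaII1_of_weightEq hs hτ₀ h01 h12 hκ hA1 hA2 hl hl' hll h
  exact ⟨τ₂, h2, fun τ' h' => ORG.HirotaII1.unique hs hτ₀ h01 h12 h' h2⟩
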